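/- Let $n \ge 2$ and $T > 0$. For $V \in L^\infty(\mathbb{R}^n)$ (complex-valued) put \[ |\!|\!| V |\!|\!| = \sum_{j \ge 0} 2^j \| V \|_{L^\infty(D_j)}, \qquad D_0 = \{ |x| \le 1 \}, \quad D_j = \{ 2^{j-1} < |x| \le 2^j \} \ (j \ge 1), \] and let $\mathcal{U}_T : L^2(\mathbb{R}^n) \to L^2(\mathbb{R}^n)$, $f \mapsto u(T, \cdot)$, be the initial-to-final-state map of $V$, where $u \in C([0,T]; L^2(\mathbb{R}^n))$ is the unique solution of $i \partial_t u = -\Delta u + V u$ in $(0,T) \times \mathbb{R}^n$ (in the sense of distributions) with $u(0, \cdot) = f$. Let $V_1, V_2 \in L^1(\mathbb{R}^n) \cap L^\infty(\mathbb{R}^n)$ satisfy $|\!|\!| V_1 |\!|\!| < \infty$ and $|\!|\!| V_2 |\!|\!| < \infty$, and let $\mathcal{U}_T^1$, $\mathcal{U}_T^2$ be their initial-to-final-state maps. If $\mathcal{U}_T^1 = \mathcal{U}_T^2$, then $V_1 = V_2$ almost everywhere in $\mathbb{R}^n$. -/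

import Mathlib

open MeasureTheory Set
open scoped ENNReal Laplacian Distributions

noncomputable section

namespace InitialToFinal

/-- Complex-valued square integrable functions on `ℝⁿ`. -/
abbrev L2 (n : ℕ) : Type :=
  Lp ℂ 2 (volume : Measure (EuclideanSpace ℝ (Fin n)))

/-- The closed unit ball `D₀` and the dyadic annuli `Dⱼ = {2^(j-1) < |x| ≤ 2^j}`, `j ≥ 1`. -/
def dyadicAnnulus (n : ℕ) : ℕ → Set (EuclideanSpace ℝ (Fin n))
  | 0 => {x | ‖x‖ ≤ 1}
  | j + 1 => {x | (2 : ℝ) ^ j < ‖x‖ ∧ ‖x‖ ≤ (2 : ℝ) ^ (j + 1)}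

/-- The quantity `⦀V⦀ = ∑ⱼ 2^j ‖V‖_{L^∞(Dⱼ)}`, which may be infinite. -/
def tripleNorm {n : ℕ} (V : EuclideanSpace ℝ (Fin n) → ℂ) : ℝ≥0∞ :=
  ∑' j : ℕ, 2 ^ j * eLpNorm V ∞ (volume.restrict (dyadicAnnulus n j))

/-- The open slab `(0, T) × ℝⁿ`. -/
def timeSlab (n : ℕ) (T : ℝ) : TopologicalSpace.Opens (ℝ × EuclideanSpace ℝ (Fin n)) :=
  ⟨Ioo 0 T ×ˢ univ, isOpen_Ioo.prod isOpen_univ⟩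

/-- `u ∈ C([0, T]; L²(ℝⁿ))` solves `i ∂ₜ u = -Δ u + V u` in `(0, T) × ℝⁿ` in the sense of
distributions, and `u(0, ·) = f`. (Values of `u` outside `[0, T]` are irrelevant.) -/
structure IsPhysicalSolution {n : ℕ} (T : ℝ) (V : EuclideanSpace ℝ (Fin n) → ℂ)
    (f : L2 n) (u : ℝ → L2 n) : Prop where
  continuousOn : ContinuousOn u (Icc 0 T)
  equation : ∀ φ : 𝓓(timeSlab n T, ℂ),
    ∫ t in (0 : ℝ)..T, ∫ x, u t x * (-Complex.I * deriv (fun s => φ (s, x)) t) =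
      ∫ t in (0 : ℝ)..T, ∫ x, u t x * (-(Δ (fun y => φ (t, y)) x) + V x * φ (t, x))
  initial : u 0 = f

open Classical in
/-- The initial-to-final-state map `𝒰_T : f ↦ u(T, ·)`, where `u` is the physical solution with
initial state `f`. For `0 ≤ T` and bounded measurable `V` this solution exists and is unique on
`[0, T]` for every `f`, so neither the choice of `u` nor the default value plays a role. -/
def initialToFinalStateMap {n : ℕ} (T : ℝ) (V : EuclideanSpace ℝ (Fin n) → ℂ) (f : L2 n) : L2 n :=
  if h : ∃ u : ℝ → L2 n, IsPhysicalSolution T V f u then h.choose T else 0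

end InitialToFinal

end

/-! A wave packet moving at speed `l` feels a localised potential only for a time of order `1/l`. To
first order in `1/l` its final state therefore records the potential integrated along its path, and
the corrections are of second order.

Take `f` a Gaussian packet starting at `c` with velocity `l ω`, `‖ω‖ = 1`. It spends time O(2^j / l)
near the ball of radius 2^j, which is exactly the weight in `tripleNorm`, so ∫₀ᵀ ‖V e^{isΔ} f‖ ds =
O(1/l) (`exists_interaction_packetLp_le`). By Duhamel, ∫₀ᵀ ⟨e^{isΔ} f, V u(s)⟩ ds depends on `f` and
`u T` alone. Replacing `u` by the free wave costs an error quadratic in the interaction; hence equal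
final states force ∫₀ᵀ ⟨e^{isΔ} f, (V₁ - V₂) e^{isΔ} f⟩ ds = O(1/l²) (`norm_integral_inner_sub_le`).

Put τ = l s and multiply by `l`. As `l → ∞` the packet has no time to spread, and the limit says
that the Gaussian averages of W = V₁ - V₂ have integral zero over the ray c + τω, τ > 0
(`integral_Ioi_gaussAvg_eq_zero`). These are rays, not full lines, because the packet sits at `c` at
time 0. Since `c` is arbitrary, differentiating along the ray kills the average itself, with a
single direction ω and no inversion of an X-ray transform (`gaussAvg_eq_zero_of_integral_Ioi`). The
Fourier transform of a Gaussian has no zeros, so W = 0 almost everywhere.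

The argument needs Duhamel's formula for distributional solutions
(`IsPhysicalSolution.isMildSolution`), and the existence of a solution for every initial state, so
that the map never takes its default value. -/

set_option linter.unusedSectionVars false

noncomputable section

namespace InitialToFinal

open FourierTransform SchwartzMap Filter Topology

/-! ### The free Schrödinger group on L² and on Schwartz functions -/

section

/-- Complex square integrable functions on a Euclidean space. -/
abbrev SqInt (E : Type*) [NormedAddCommGroup E] [InnerProductSpace ℝ E] [FiniteDimensional ℝ E]
    [MeasurableSpace E] [BorelSpace E] : Type _ :=
  Lp ℂ 2 (volume : Measure E)

variable {E : Type*} [NormedAddCommGroup E] [InnerProductSpace ℝ E] [FiniteDimensional ℝ E]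
  [MeasurableSpace E] [BorelSpace E]

/-- Multiplication by an essentially bounded function on `L²`. -/
def mulOp (m : Lp ℂ ∞ (volume : Measure E)) : SqInt E →L[ℂ] SqInt E :=
  (ContinuousLinearMap.mul ℂ ℂ).holderL volume ∞ 2 2 m

theorem coeFn_mulOp (m : Lp ℂ ∞ (volume : Measure E)) (f : SqInt E) :
    mulOp m f =ᵐ[volume] fun x => m x * f x :=
  (ContinuousLinearMap.mul ℂ ℂ).coeFn_holder m f

theorem coeFn_mulOp_toLp {m : E → ℂ} (hm : MemLp m ∞ volume) (f : SqInt E) :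
    mulOp hm.toLp f =ᵐ[volume] fun x => m x * f x := by
  filter_upwards [coeFn_mulOp hm.toLp f, hm.coeFn_toLp] with x h1 h2
  rw [h1, h2]

/-- The symbol `e^{-4π²it|ξ|²}` of the free Schrödinger propagator. -/
def freeSymbol (t : ℝ) (ξ : E) : ℂ := Complex.exp (((-(4 * Real.pi ^ 2 * t * ‖ξ‖ ^ 2) : ℝ) : ℂ) * Complex.I)

theorem norm_freeSymbol (t : ℝ) (ξ : E) : ‖freeSymbol t ξ‖ = 1 :=
  Complex.norm_exp_ofReal_mul_I _

theorem freeSymbol_add (s t : ℝ) (ξ : E) :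
    freeSymbol (s + t) ξ = freeSymbol s ξ * freeSymbol t ξ := by
  rw [freeSymbol, freeSymbol, freeSymbol, ← Complex.exp_add]
  congr 1
  push_cast
  ring

theorem freeSymbol_zero (ξ : E) : freeSymbol 0 ξ = 1 := by
  simp [freeSymbol]

theorem continuous_freeSymbol (t : ℝ) : Continuous (freeSymbol t : E → ℂ) := by
  unfold freeSymbol
  fun_prop

theorem memLp_freeSymbol (t : ℝ) : MemLp (freeSymbol t : E → ℂ) ∞ volume :=
  memLp_top_of_bound (continuous_freeSymbol t).aestronglyMeasurable 1
    (Eventually.of_forall fun ξ => (norm_freeSymbol t ξ).le)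

theorem hasTemperateGrowth_exp_ofReal_mul_I :
    (fun θ : ℝ => Complex.exp ((θ : ℂ) * Complex.I)).HasTemperateGrowth := by
  have hc : ContDiff ℝ (⊤ : ℕ∞) fun θ : ℝ => Complex.exp ((θ : ℂ) * Complex.I) :=
    (Complex.ofRealCLM.contDiff.mul contDiff_const).cexp
  refine ⟨hc, fun k => ⟨0, 1, fun θ => ?_⟩⟩
  have key : ∀ k : ℕ, iteratedDeriv k (fun θ : ℝ => Complex.exp ((θ : ℂ) * Complex.I)) =
      fun θ : ℝ => Complex.I ^ k * Complex.exp ((θ : ℂ) * Complex.I) := by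
    intro k
    induction k with
    | zero => simp
    | succ k ih =>
      rw [iteratedDeriv_succ, ih]
      funext θ
      have h : HasDerivAt (fun θ : ℝ => Complex.I ^ k * Complex.exp ((θ : ℂ) * Complex.I))
          (Complex.I ^ k * (Complex.exp ((θ : ℂ) * Complex.I) * (1 * Complex.I))) θ :=
        (((Complex.ofRealCLM.hasDerivAt (x := θ)).mul_const Complex.I).cexp).const_mul _
      rw [h.deriv, pow_succ]
      ring
  rw [norm_iteratedFDeriv_eq_norm_iteratedDeriv, key]
  simp [Complex.norm_exp_ofReal_mul_I]

theorem hasTemperateGrowth_freeSymbol (t : ℝ) : (freeSymbol t : E → ℂ).HasTemperateGrowth := by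
  have h : (fun ξ : E => -(4 * Real.pi ^ 2 * t * ‖ξ‖ ^ 2)).HasTemperateGrowth := by
    have := (Function.HasTemperateGrowth.const (E := E) (4 * Real.pi ^ 2 * t)).mul
      (Function.hasTemperateGrowth_norm_sq E)
    exact this.neg
  exact hasTemperateGrowth_exp_ofReal_mul_I.comp h

/-- The free propagator `e^{itΔ}` on `L²`. -/
def freeProp (t : ℝ) : SqInt E →L[ℂ] SqInt E :=
  (Lp.fourierTransformₗᵢ E ℂ).symm.toContinuousLinearEquiv.toContinuousLinearMap ∘L
    mulOp (memLp_freeSymbol t).toLp ∘L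
    (Lp.fourierTransformₗᵢ E ℂ).toContinuousLinearEquiv.toContinuousLinearMap

theorem freeProp_apply (t : ℝ) (f : SqInt E) :
    freeProp t f = 𝓕⁻ (mulOp (memLp_freeSymbol t).toLp (𝓕 f)) := rfl

theorem fourier_freeProp (t : ℝ) (f : SqInt E) :
    𝓕 (freeProp t f) = mulOp (memLp_freeSymbol t).toLp (𝓕 f) := by
  rw [freeProp_apply, fourier_fourierInv_eq]

theorem norm_mulOp_freeSymbol (t : ℝ) (f : SqInt E) :
    ‖mulOp (memLp_freeSymbol t).toLp f‖ = ‖f‖ := by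
  rw [Lp.norm_def, Lp.norm_def]
  congr 1
  apply eLpNorm_congr_norm_ae
  filter_upwards [coeFn_mulOp_toLp (memLp_freeSymbol (E := E) t) f] with x hx
  rw [hx, norm_mul, norm_freeSymbol, one_mul]

@[simp]
theorem norm_freeProp (t : ℝ) (f : SqInt E) : ‖freeProp t f‖ = ‖f‖ := by
  rw [← Lp.norm_fourier_eq, fourier_freeProp, norm_mulOp_freeSymbol, Lp.norm_fourier_eq]

theorem fourier_injective : Function.Injective (𝓕 : SqInt E → SqInt E) :=
  (Lp.fourierTransformₗᵢ E ℂ).injective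

theorem freeProp_add (s t : ℝ) (f : SqInt E) :
    freeProp (s + t) f = freeProp s (freeProp t f) := by
  apply fourier_injective
  rw [fourier_freeProp, fourier_freeProp, fourier_freeProp]
  apply Lp.ext
  filter_upwards [coeFn_mulOp_toLp (memLp_freeSymbol (E := E) (s + t)) (𝓕 f),
    coeFn_mulOp_toLp (memLp_freeSymbol (E := E) t) (𝓕 f),
    coeFn_mulOp_toLp (memLp_freeSymbol (E := E) s) (mulOp (memLp_freeSymbol t).toLp (𝓕 f))]
    with x h1 h2 h3
  rw [h1, h3, h2, freeSymbol_add, mul_assoc]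

@[simp]
theorem freeProp_zero (f : SqInt E) : freeProp 0 f = f := by
  apply fourier_injective
  rw [fourier_freeProp]
  apply Lp.ext
  filter_upwards [coeFn_mulOp_toLp (memLp_freeSymbol (E := E) 0) (𝓕 f)] with x h1
  rw [h1, freeSymbol_zero, one_mul]

@[simp]
theorem freeProp_neg_freeProp (t : ℝ) (f : SqInt E) : freeProp (-t) (freeProp t f) = f := by
  rw [← freeProp_add]; simp

@[simp]
theorem freeProp_freeProp_neg (t : ℝ) (f : SqInt E) : freeProp t (freeProp (-t) f) = f := by
  rw [← freeProp_add]; simp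

/-- The free propagator as a linear isometry. -/
def freePropIsometry (t : ℝ) : SqInt E →ₗᵢ[ℂ] SqInt E := ⟨(freeProp t).toLinearMap, norm_freeProp t⟩

theorem inner_freeProp_freeProp (t : ℝ) (f g : SqInt E) :
    inner ℂ (freeProp t f) (freeProp t g) = inner ℂ f g :=
  (freePropIsometry t).inner_map_map f g

theorem inner_freeProp_left (t : ℝ) (f g : SqInt E) :
    inner ℂ (freeProp t f) g = inner ℂ f (freeProp (-t) g) := by
  rw [← inner_freeProp_freeProp t f, freeProp_freeProp_neg]

/-- The inclusion of the Schwartz functions into `L²`. -/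
def toSq : 𝓢(E, ℂ) →L[ℂ] SqInt E := toLpCLM ℂ ℂ 2 volume

theorem coeFn_toSq (g : 𝓢(E, ℂ)) : toSq g =ᵐ[volume] g := g.coeFn_toLp 2 volume

theorem fourier_toSq (g : 𝓢(E, ℂ)) : 𝓕 (toSq g) = toSq (𝓕 g) := toLp_fourier_eq g

theorem denseRange_toSq : DenseRange (toSq : 𝓢(E, ℂ) → SqInt E) :=
  denseRange_toLpCLM ENNReal.ofNat_ne_top

/-- The free propagator on Schwartz functions. -/
def schwartzProp (t : ℝ) (g : 𝓢(E, ℂ)) : 𝓢(E, ℂ) := fourierMultiplierCLM ℂ (freeSymbol t : E → ℂ) g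

theorem fourier_schwartzProp_apply (t : ℝ) (g : 𝓢(E, ℂ)) (ξ : E) :
    𝓕 (schwartzProp t g) ξ = freeSymbol t ξ * 𝓕 g ξ := by
  rw [schwartzProp, fourierMultiplierCLM_apply, fourier_fourierInv_eq,
    smulLeftCLM_apply_apply (hasTemperateGrowth_freeSymbol t), smul_eq_mul]

theorem freeProp_toSq (t : ℝ) (g : 𝓢(E, ℂ)) :
    freeProp t (toSq g) = toSq (schwartzProp t g) := by
  apply fourier_injective
  rw [fourier_freeProp, fourier_toSq, fourier_toSq]
  apply Lp.ext
  filter_upwards [coeFn_mulOp_toLp (memLp_freeSymbol (E := E) t) (toSq (𝓕 g)),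
    coeFn_toSq (𝓕 g), coeFn_toSq (𝓕 (schwartzProp t g))] with x h1 h2 h3
  rw [h1, h2, h3, fourier_schwartzProp_apply]

theorem fourier_laplacian_apply (g : 𝓢(E, ℂ)) (ξ : E) :
    𝓕 (Δ g) ξ = -(((2 * Real.pi) ^ 2 * ‖ξ‖ ^ 2 : ℝ) : ℂ) * 𝓕 g ξ := by
  have h : (fun x : E => ‖x‖ ^ 2).HasTemperateGrowth := Function.hasTemperateGrowth_norm_sq E
  rw [laplacian_eq_fourierMultiplierCLM, FourierTransform.fourier_smul, fourierMultiplierCLM_apply,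
    fourier_fourierInv_eq, smul_apply, smulLeftCLM_apply_apply h]
  simp
  ring

theorem laplacian_schwartzProp (t : ℝ) (g : 𝓢(E, ℂ)) :
    Δ (schwartzProp t g) = schwartzProp t (Δ g) := by
  apply (fourierEquiv ℂ 𝓢(E, ℂ)).injective
  ext ξ
  change 𝓕 (Δ (schwartzProp t g)) ξ = 𝓕 (schwartzProp t (Δ g)) ξ
  rw [fourier_laplacian_apply, fourier_schwartzProp_apply, fourier_schwartzProp_apply,
    fourier_laplacian_apply]
  ring

/-- Taylor's bound serves for |a| ≤ 1. Otherwise the left side is at most |a| + |a|, which is below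
2a². -/
theorem norm_exp_mul_I_sub_one_sub_le (a : ℝ) :
    ‖Complex.exp ((a : ℂ) * Complex.I) - 1 - (a : ℂ) * Complex.I‖ ≤ 2 * a ^ 2 := by
  by_cases ha : |a| ≤ 1
  · have := Complex.norm_exp_sub_one_sub_id_le (x := (a : ℂ) * Complex.I) (by simpa using ha)
    have h2 : ‖(a : ℂ) * Complex.I‖ ^ 2 = a ^ 2 := by simp
    nlinarith [sq_nonneg a]
  · push Not at ha
    have h1 := Real.norm_exp_I_mul_ofReal_sub_one_le (x := a)
    rw [mul_comm, Real.norm_eq_abs] at h1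
    have h2 := norm_sub_le (Complex.exp ((a : ℂ) * Complex.I) - 1) ((a : ℂ) * Complex.I)
    have h3 : ‖(a : ℂ) * Complex.I‖ = |a| := by simp
    nlinarith [sq_abs a, abs_nonneg a]

/-- By Plancherel this is the Taylor bound for the symbol at -h(2π|ξ|)²; the square (2π|ξ|)⁴ that it
produces is the symbol of Δ². -/
theorem norm_freeProp_sub_sub_le (h : ℝ) (g : 𝓢(E, ℂ)) :
    ‖freeProp h (toSq g) - toSq g - h • toSq (Complex.I • (Δ g))‖ ≤
      2 * h ^ 2 * ‖toSq (Δ (Δ g))‖ := by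
  have e1 : freeProp h (toSq g) - toSq g - h • toSq (Complex.I • (Δ g)) =
      toSq (schwartzProp h g - g - h • (Complex.I • (Δ g))) := by
    rw [freeProp_toSq]
    rw [map_sub, map_sub, toSq.map_smul_of_tower h]
  rw [e1, ← Lp.norm_fourier_eq (toSq _), ← Lp.norm_fourier_eq (toSq (Δ (Δ g))), fourier_toSq,
    fourier_toSq]
  apply Lp.norm_le_mul_norm_of_ae_le_mul
  filter_upwards [coeFn_toSq (𝓕 (schwartzProp h g - g - h • (Complex.I • (Δ g)))),
    coeFn_toSq (𝓕 (Δ (Δ g)))] with ξ h1 h2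
  rw [h1, h2]
  set a : ℝ := (2 * Real.pi) ^ 2 * ‖ξ‖ ^ 2 with ha
  have e2 : 𝓕 (schwartzProp h g - g - h • (Complex.I • (Δ g))) ξ =
      (Complex.exp (((-(h * a) : ℝ) : ℂ) * Complex.I) - 1 - ((-(h * a) : ℝ) : ℂ) * Complex.I) *
        𝓕 g ξ := by
    have e3 : 𝓕 (schwartzProp h g - g - h • (Complex.I • (Δ g))) =
        𝓕 (schwartzProp h g) - 𝓕 g - h • (Complex.I • 𝓕 (Δ g)) := by
      change fourierCLM ℂ 𝓢(E, ℂ) _ = fourierCLM ℂ 𝓢(E, ℂ) _ - fourierCLM ℂ 𝓢(E, ℂ) _ -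
        h • (Complex.I • fourierCLM ℂ 𝓢(E, ℂ) _)
      rw [map_sub, map_sub, (fourierCLM ℂ 𝓢(E, ℂ)).map_smul_of_tower h, map_smul]
    rw [e3]
    simp only [sub_apply, smul_apply, fourier_schwartzProp_apply, fourier_laplacian_apply,
      freeSymbol]
    rw [← ha, show 4 * Real.pi ^ 2 * h * ‖ξ‖ ^ 2 = h * a by rw [ha]; ring]
    simp only [smul_eq_mul, Complex.real_smul]
    push_cast
    ring
  rw [e2, fourier_laplacian_apply, fourier_laplacian_apply, ← ha, norm_mul]
  have e4 := norm_exp_mul_I_sub_one_sub_le (-(h * a))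
  have e5 : ‖-(a : ℂ) * (-(a : ℂ) * 𝓕 g ξ)‖ = a ^ 2 * ‖𝓕 g ξ‖ := by
    rw [norm_mul, norm_mul, norm_neg, Complex.norm_real, ← mul_assoc, ← sq, Real.norm_eq_abs,
      sq_abs]
  rw [e5]
  nlinarith [norm_nonneg (𝓕 g ξ)]

theorem hasDerivAt_freeProp_toSq (g : 𝓢(E, ℂ)) (t : ℝ) :
    HasDerivAt (fun s => freeProp s (toSq g)) (freeProp t (toSq (Complex.I • (Δ g)))) t := by
  rw [hasDerivAt_iff_isLittleO_nhds_zero]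
  refine Asymptotics.IsBigO.trans_isLittleO (g := fun h : ℝ => h ^ 2) ?_ ?_
  · refine Asymptotics.IsBigO.of_bound (2 * ‖toSq (Δ (Δ g))‖)
      (Eventually.of_forall fun h => ?_)
    rw [freeProp_add, ← ContinuousLinearMap.map_smul_of_tower, ← map_sub, ← map_sub, norm_freeProp]
    have := norm_freeProp_sub_sub_le h g
    rw [Real.norm_eq_abs, abs_of_nonneg (sq_nonneg h)]
    linarith
  · exact Asymptotics.isLittleO_pow_id one_lt_two

/-- The propagators are isometries, so continuity passes from the dense Schwartz functions to all of
L² by an ε/3 argument. -/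
theorem continuous_freeProp_apply (f : SqInt E) : Continuous fun t => freeProp t f := by
  rw [Metric.continuous_iff]
  intro t ε hε
  obtain ⟨g, hg⟩ := denseRange_toSq.exists_dist_lt f (show 0 < ε / 3 by positivity)
  obtain ⟨δ, hδ, h⟩ := Metric.continuousAt_iff.1 (hasDerivAt_freeProp_toSq g t).continuousAt
    (ε / 3) (by positivity)
  refine ⟨δ, hδ, fun s hs => ?_⟩
  have h1 : ∀ r, dist (freeProp r f) (freeProp r (toSq g)) < ε / 3 := by
    intro r
    rw [dist_eq_norm, ← map_sub, norm_freeProp, ← dist_eq_norm]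
    exact hg
  have h2 := h1 t
  rw [dist_comm] at h2
  calc dist (freeProp s f) (freeProp t f) ≤ dist (freeProp s f) (freeProp s (toSq g)) +
        dist (freeProp s (toSq g)) (freeProp t (toSq g)) +
        dist (freeProp t (toSq g)) (freeProp t f) := dist_triangle4 _ _ _ _
    _ < ε / 3 + ε / 3 + ε / 3 := by gcongr; exacts [h1 s, h hs]
    _ = ε := by ring

theorem tendsto_freeProp_apply {ι : Type*} {l : Filter ι} {a : ι → ℝ} {w : ι → SqInt E} {t : ℝ}
    {f : SqInt E} (ha : Tendsto a l (𝓝 t)) (hw : Tendsto w l (𝓝 f)) :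
    Tendsto (fun i => freeProp (a i) (w i)) l (𝓝 (freeProp t f)) := by
  have h1 : Tendsto (fun i => freeProp (a i) (w i - f)) l (𝓝 0) := by
    rw [tendsto_zero_iff_norm_tendsto_zero]
    simp only [norm_freeProp]
    rw [← tendsto_zero_iff_norm_tendsto_zero]
    simpa using hw.sub_const f
  have h2 := ((continuous_freeProp_apply f).tendsto t).comp ha
  simpa using h1.add h2

theorem continuous_freeProp {X : Type*} [TopologicalSpace X] {a : X → ℝ} {w : X → SqInt E}
    (ha : Continuous a) (hw : Continuous w) : Continuous fun x => freeProp (a x) (w x) :=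
  continuous_iff_continuousAt.2 fun x => tendsto_freeProp_apply (ha.tendsto x) (hw.tendsto x)

end

/-! ### Mild solutions: existence by a weighted contraction -/

section

theorem intervalIntegral_exp_neg_mul_sub_le {μ t : ℝ} (hμ : 0 < μ) :
    ∫ s in (0 : ℝ)..t, Real.exp (-(μ * (t - s))) ≤ 1 / μ := by
  have h : ∀ s ∈ uIcc 0 t, HasDerivAt (fun s => Real.exp (-(μ * (t - s))) / μ)
      (Real.exp (-(μ * (t - s)))) s := by
    intro s _
    have h1 : HasDerivAt (fun s => -(μ * (t - s))) μ s := by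
      have := (((hasDerivAt_id s).const_sub t).const_mul μ).fun_neg
      simpa using this
    have h2 := h1.exp.div_const μ
    rwa [mul_div_cancel_right₀ _ hμ.ne'] at h2
  rw [intervalIntegral.integral_eq_sub_of_hasDerivAt h
    ((by fun_prop : Continuous fun s => Real.exp (-(μ * (t - s)))).intervalIntegrable _ _)]
  have h3 : 0 ≤ Real.exp (-(μ * (t - 0))) / μ := by positivity
  simpa using h3

/-- With v(t) = e^{μt} w(t) the equation becomes w(t) = e^{-μt} f + ∫₀ᵗ e^{-μ(t-s)} B(s, w(s)) ds.
The integral term has Lipschitz constant at most C/μ whatever `T` is, so one contraction covers the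
whole interval. -/
theorem exists_continuous_linear_volterra {H : Type*} [NormedAddCommGroup H] [NormedSpace ℝ H]
    [CompleteSpace H] {T C : ℝ} (hT : 0 ≤ T) (hC : 0 < C) (B : ℝ → H → H)
    (hsmul : ∀ s (c : ℝ) x, B s (c • x) = c • B s x)
    (hlip : ∀ s x y, ‖B s x - B s y‖ ≤ C * ‖x - y‖)
    (hcont : ∀ w : ℝ → H, Continuous w → Continuous fun s => B s (w s)) (f : H) :
    ∃ v : ℝ → H, Continuous v ∧ ∀ t ∈ Icc 0 T, v t = f + ∫ s in (0 : ℝ)..t, B s (v s) := by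
  -- This choice makes the contraction constant C/μ equal to 1/2.
  set μ : ℝ := 2 * C with hμ
  have hμ0 : 0 < μ := by positivity
  let ext : C(Icc (0 : ℝ) T, H) → ℝ → H := fun w s => w (projIcc 0 T hT s)
  have hext : ∀ w, Continuous (ext w) := fun w => w.continuous.comp continuous_projIcc
  let g : C(Icc (0 : ℝ) T, H) → ℝ → ℝ → H := fun w t s =>
    Real.exp (-(μ * (t - s))) • B s (ext w s)
  have hg : ∀ w t, Continuous (g w t) := fun w t =>
    (by fun_prop : Continuous fun s => Real.exp (-(μ * (t - s)))).smul (hcont _ (hext w))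
  have hgi : ∀ w t, ∫ s in (0 : ℝ)..t, g w t s =
      Real.exp (-(μ * t)) • ∫ s in (0 : ℝ)..t, Real.exp (μ * s) • B s (ext w s) := by
    intro w t
    rw [← intervalIntegral.integral_smul]
    congr 1
    funext s
    rw [smul_smul, ← Real.exp_add, show -(μ * t) + μ * s = -(μ * (t - s)) by ring]
  have hgc : ∀ w, Continuous fun t => ∫ s in (0 : ℝ)..t, g w t s := by
    intro w
    simp_rw [hgi]
    refine (by fun_prop : Continuous fun t => Real.exp (-(μ * t))).smul ?_
    refine intervalIntegral.continuous_primitive (fun a b => ?_) 0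
    exact ((by fun_prop : Continuous fun s => Real.exp (μ * s)).smul
      (hcont _ (hext w))).intervalIntegrable _ _
  let Φ : C(Icc (0 : ℝ) T, H) → C(Icc (0 : ℝ) T, H) := fun w =>
    ⟨fun t => Real.exp (-(μ * t)) • f + ∫ s in (0 : ℝ)..t, g w t s, by
      have h1 : Continuous fun t : ℝ => Real.exp (-(μ * t)) • f + ∫ s in (0 : ℝ)..t, g w t s :=
        ((by fun_prop : Continuous fun t => Real.exp (-(μ * t))).smul continuous_const).add (hgc w)
      exact h1.comp continuous_subtype_val⟩
  have hΦ : ContractingWith (1 / 2) Φ := by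
    refine ⟨by rw [← NNReal.coe_lt_coe]; norm_num, LipschitzWith.of_dist_le_mul fun w₁ w₂ => ?_⟩
    rw [ContinuousMap.dist_le (by positivity)]
    intro t
    have e1 : Φ w₁ t - Φ w₂ t = ∫ s in (0 : ℝ)..t, (g w₁ t s - g w₂ t s) := by
      rw [intervalIntegral.integral_sub ((hg w₁ t).intervalIntegrable _ _)
        ((hg w₂ t).intervalIntegrable _ _)]
      simp only [Φ, ContinuousMap.coe_mk]
      abel
    rw [dist_eq_norm, e1]
    have hb : ∀ s, ‖g w₁ t s - g w₂ t s‖ ≤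
        Real.exp (-(μ * (t - s))) * (C * dist w₁ w₂) := by
      intro s
      simp only [g]
      rw [← smul_sub, norm_smul, Real.norm_eq_abs, abs_of_pos (Real.exp_pos _)]
      gcongr
      refine (hlip _ _ _).trans ?_
      gcongr
      rw [← dist_eq_norm]
      exact ContinuousMap.dist_apply_le_dist _
    calc ‖∫ s in (0 : ℝ)..t, (g w₁ t s - g w₂ t s)‖
        ≤ ∫ s in (0 : ℝ)..t, Real.exp (-(μ * (t - s))) * (C * dist w₁ w₂) :=
          intervalIntegral.norm_integral_le_of_norm_le t.2.1
            (Eventually.of_forall fun s _ => hb s)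
            ((by fun_prop : Continuous fun s =>
              Real.exp (-(μ * (t - s))) * (C * dist w₁ w₂)).intervalIntegrable _ _)
      _ = (∫ s in (0 : ℝ)..t, Real.exp (-(μ * (t - s)))) * (C * dist w₁ w₂) := by
          rw [intervalIntegral.integral_mul_const]
      _ ≤ 1 / μ * (C * dist w₁ w₂) := by
          gcongr
          exact intervalIntegral_exp_neg_mul_sub_le hμ0
      _ = ((1 / 2 : NNReal) : ℝ) * dist w₁ w₂ := by
          rw [hμ]; push_cast; field_simp
  obtain ⟨w, hw, -⟩ := hΦ.exists_fixedPoint 0 (edist_ne_top _ _)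
  refine ⟨fun t => Real.exp (μ * t) • ext w t,
    (by fun_prop : Continuous fun t => Real.exp (μ * t)).smul (hext w), fun t ht => ?_⟩
  have h1 : ext w t = Real.exp (-(μ * t)) • f + ∫ s in (0 : ℝ)..t, g w t s := by
    have : ext w t = w ⟨t, ht⟩ := by simp only [ext]; rw [projIcc_of_mem hT ht]
    rw [this]
    conv_lhs => rw [← hw]
    rfl
  simp only [hsmul]
  rw [h1, hgi, smul_add, smul_smul, smul_smul, ← Real.exp_add]
  simp

variable {E : Type*} [NormedAddCommGroup E] [InnerProductSpace ℝ E] [FiniteDimensional ℝ E]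
  [MeasurableSpace E] [BorelSpace E]

/-- `u` is a continuous solution on `[0, T]` of Duhamel's formula
`u(t) = e^{itΔ} (f - i ∫₀ᵗ e^{-isΔ} V u(s) ds)`. -/
structure IsMildSolution (T : ℝ) (V : SqInt E →L[ℂ] SqInt E) (f : SqInt E) (u : ℝ → SqInt E) :
    Prop where
  continuous : Continuous u
  duhamel : ∀ t ∈ Icc 0 T,
    u t = freeProp t (f + ∫ s in (0 : ℝ)..t, (-Complex.I) • freeProp (-s) (V (u s)))

/-- In the interaction picture v(t) = e^{-itΔ} u(t) the unbounded Laplacian disappears, leaving a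
Volterra equation with the bounded coefficients -i e^{-isΔ} V e^{isΔ}. -/
theorem exists_isMildSolution {T : ℝ} (hT : 0 ≤ T) (V : SqInt E →L[ℂ] SqInt E) (f : SqInt E) :
    ∃ u, IsMildSolution T V f u := by
  obtain ⟨v, hv, h⟩ := exists_continuous_linear_volterra hT (C := ‖V‖ + 1) (by positivity)
    (fun s x => (-Complex.I) • freeProp (-s) (V (freeProp s x)))
    (fun s c x => by
      rw [ContinuousLinearMap.map_smul_of_tower, ContinuousLinearMap.map_smul_of_tower,
        ContinuousLinearMap.map_smul_of_tower, smul_comm])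
    (fun s x y => by
      rw [← smul_sub, ← map_sub, ← map_sub, ← map_sub, norm_smul, norm_freeProp]
      have h1 := V.le_opNorm (freeProp s (x - y))
      rw [norm_freeProp] at h1
      have h2 : ‖-Complex.I‖ = 1 := by simp
      rw [h2]
      nlinarith [norm_nonneg (x - y)])
    (fun w hw => (continuous_freeProp continuous_neg
      (V.continuous.comp (continuous_freeProp continuous_id hw))).const_smul (-Complex.I)) f
  refine ⟨fun t => freeProp t (v t), continuous_freeProp continuous_id hv, fun t ht => ?_⟩
  conv_lhs => rw [h t ht]

end

/-! ### Space-time test functions as differentiable curves in L² -/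

section

open scoped ComplexConjugate ContDiff

variable {E : Type*} [NormedAddCommGroup E] [InnerProductSpace ℝ E] [FiniteDimensional ℝ E]
  [MeasurableSpace E] [BorelSpace E]

theorem inner_toSq (g : 𝓢(E, ℂ)) (u : SqInt E) :
    inner ℂ (toSq g) u = ∫ x, u x * conj (g x) := by
  rw [L2.inner_def]
  apply integral_congr_ae
  filter_upwards [coeFn_toSq g] with x hx
  rw [hx]
  rfl

theorem integrable_mul_conj (g : 𝓢(E, ℂ)) (u : SqInt E) :
    Integrable fun x => u x * conj (g x) := by
  refine (L2.integrable_inner (𝕜 := ℂ) (toSq g) u).congr ?_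
  filter_upwards [coeFn_toSq g] with x hx
  rw [hx]
  rfl

/-- All time slices of a test function live on one compact set; this turns estimates uniform in `x`
into L² estimates. -/
theorem norm_toSq_le {K : Set E} (hK : IsCompact K) {M : ℝ} (hM : 0 ≤ M) (g : 𝓢(E, ℂ))
    (hb : ∀ x, ‖g x‖ ≤ M) (hs : ∀ x, x ∉ K → g x = 0) :
    ‖toSq g‖ ≤ M * (volume.real K) ^ (1 / 2 : ℝ) := by
  have hK' : volume K ≠ ⊤ := hK.measure_lt_top.ne
  have h1 : ‖toSq g‖ ≤ ‖indicatorConstLp 2 hK.measurableSet hK' M‖ := by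
    apply Lp.norm_le_norm_of_ae_le
    filter_upwards [coeFn_toSq g,
      indicatorConstLp_coeFn (p := 2) (hs := hK.measurableSet) (hμs := hK')
      (c := M)] with x hx hx'
    rw [hx, hx']
    by_cases hxK : x ∈ K
    · rw [indicator_of_mem hxK, Real.norm_eq_abs, abs_of_nonneg hM]
      exact hb x
    · rw [hs x hxK]
      simp
  refine h1.trans ?_
  rw [norm_indicatorConstLp two_ne_zero ENNReal.ofNat_ne_top, Real.norm_eq_abs, abs_of_nonneg hM]
  simp

/-- The slice at time `t` of a smooth compactly supported function on space-time. -/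
def slice {φ : ℝ × E → ℂ} (hφ : HasCompactSupport φ) (hφ' : ContDiff ℝ ∞ φ) (t : ℝ) : 𝓢(E, ℂ) :=
  HasCompactSupport.toSchwartzMap (f := fun x => φ (t, x))
    (hφ.comp_isClosedEmbedding (Topology.IsClosedEmbedding.of_continuous_injective_isClosedMap
      (by fun_prop) (fun x y h => (Prod.mk.inj h).2) (isClosedMap_prodMk_left t)))
    (hφ'.comp (contDiff_prodMk_right t))

theorem slice_apply {φ : ℝ × E → ℂ} (hφ : HasCompactSupport φ) (hφ' : ContDiff ℝ ∞ φ) (t : ℝ)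
    (x : E) : slice hφ hφ' t x = φ (t, x) := rfl

theorem slice_eq_zero {φ : ℝ × E → ℂ} {t : ℝ} {x : E}
    (hx : x ∉ Prod.snd '' tsupport φ) : φ (t, x) = 0 := by
  by_contra h
  exact hx ⟨(t, x), subset_tsupport _ h, rfl⟩

theorem isCompact_snd_image_tsupport {φ : ℝ × E → ℂ} (hφ : HasCompactSupport φ) :
    IsCompact (Prod.snd '' tsupport φ) :=
  hφ.isCompact.image continuous_snd

theorem exists_lipschitz_time {φ : ℝ × E → ℂ} (hφ : HasCompactSupport φ)
    (hφ' : ContDiff ℝ ∞ φ) :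
    ∃ L : ℝ, 0 ≤ L ∧ ∀ s t x, ‖φ (s, x) - φ (t, x)‖ ≤ L * |s - t| := by
  obtain ⟨C, hC⟩ := hφ'.lipschitzWith_of_hasCompactSupport hφ (by simp)
  refine ⟨C, C.2, fun s t x => ?_⟩
  have := hC.dist_le_mul (s, x) (t, x)
  rw [dist_eq_norm] at this
  refine this.trans (le_of_eq ?_)
  rw [Prod.dist_eq, dist_self, max_eq_left dist_nonneg, Real.dist_eq]

theorem continuous_toSq_slice {φ : ℝ × E → ℂ} (hφ : HasCompactSupport φ)
    (hφ' : ContDiff ℝ ∞ φ) : Continuous fun t => toSq (slice hφ hφ' t) := by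
  obtain ⟨L, hL, h⟩ := exists_lipschitz_time hφ hφ'
  set c := (volume.real (Prod.snd '' tsupport φ)) ^ (1 / 2 : ℝ)
  have hc : 0 ≤ c := by positivity
  refine (LipschitzWith.of_dist_le_mul (K := ⟨L * c, by positivity⟩) fun s t => ?_).continuous
  rw [dist_eq_norm, ← map_sub]
  refine (norm_toSq_le (isCompact_snd_image_tsupport hφ) (M := L * |s - t|) (by positivity) _
    (fun x => h s t x) (fun x hx => ?_)).trans (le_of_eq ?_)
  · rw [sub_apply, slice_apply, slice_apply, slice_eq_zero hx, slice_eq_zero hx, sub_zero]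
  · rw [Real.dist_eq]
    change L * |s - t| * c = L * c * |s - t|
    ring

theorem hasCompactSupport_fderiv_apply {φ : ℝ × E → ℂ} (hφ : HasCompactSupport φ)
    (m : ℝ × E) : HasCompactSupport fun p => fderiv ℝ φ p m :=
  hφ.fderiv_apply ℝ m

theorem contDiff_fderiv_apply {φ : ℝ × E → ℂ} (hφ' : ContDiff ℝ ∞ φ) (m : ℝ × E) :
    ContDiff ℝ ∞ fun p => fderiv ℝ φ p m :=
  (hφ'.fderiv_right (m := ∞) (by simp)).clm_apply contDiff_const

theorem hasDerivAt_time {φ : ℝ × E → ℂ} (hφ' : ContDiff ℝ ∞ φ) (t : ℝ) (x : E) :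
    HasDerivAt (fun s => φ (s, x)) (fderiv ℝ φ (t, x) (1, 0)) t := by
  have h1 : HasFDerivAt φ (fderiv ℝ φ (t, x)) (t, x) :=
    (hφ'.differentiable (by simp) _).hasFDerivAt
  have h2 : HasDerivAt (fun s : ℝ => (s, x)) ((1 : ℝ), (0 : E)) t :=
    (hasDerivAt_id t).prodMk (hasDerivAt_const t x)
  exact h1.comp_hasDerivAt t h2

/-- The time derivative is Lipschitz in time uniformly in `x`, so the first order remainder is O(r²)
in the sup norm, hence in L². -/
theorem hasDerivAt_toSq_slice {φ : ℝ × E → ℂ} (hφ : HasCompactSupport φ)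
    (hφ' : ContDiff ℝ ∞ φ) (t : ℝ) :
    HasDerivAt (fun t => toSq (slice hφ hφ' t))
      (toSq (slice (hasCompactSupport_fderiv_apply hφ (1, 0)) (contDiff_fderiv_apply hφ' (1, 0)) t))
      t := by
  set φ' : ℝ × E → ℂ := fun p => fderiv ℝ φ p (1, 0) with hφd
  obtain ⟨L, hL, h⟩ := exists_lipschitz_time (hasCompactSupport_fderiv_apply hφ (1, 0))
    (contDiff_fderiv_apply hφ' (1, 0))
  set c := (volume.real (Prod.snd '' tsupport φ)) ^ (1 / 2 : ℝ)
  rw [hasDerivAt_iff_isLittleO_nhds_zero]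
  refine Asymptotics.IsBigO.trans_isLittleO (g := fun h : ℝ => h ^ 2) ?_
    (Asymptotics.isLittleO_pow_id one_lt_two)
  refine Asymptotics.IsBigO.of_bound (L * c) (Eventually.of_forall fun r => ?_)
  rw [← map_sub, ← toSq.map_smul_of_tower r, ← map_sub]
  refine (norm_toSq_le (isCompact_snd_image_tsupport hφ) (M := L * r ^ 2) (by positivity) _
    (fun x => ?_) (fun x hx => ?_)).trans (le_of_eq ?_)
  -- The mean value inequality is applied after subtracting the tangent line at `t`, whose slope
  -- differs from that of φ by at most L|r| on the interval.
  · have hd : ∀ s ∈ uIcc t (t + r), HasDerivWithinAt (fun s => φ (s, x) - (s - t) • φ' (t, x))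
        (φ' (s, x) - φ' (t, x)) (uIcc t (t + r)) s := by
      intro s _
      have h1 := (((hasDerivAt_id s).sub_const t).smul_const (φ' (t, x)))
      rw [one_smul] at h1
      exact ((hasDerivAt_time hφ' s x).sub h1).hasDerivWithinAt
    have hb : ∀ s ∈ uIcc t (t + r), ‖φ' (s, x) - φ' (t, x)‖ ≤ L * |r| := by
      intro s hs
      refine (h s t x).trans ?_
      have := abs_sub_left_of_mem_uIcc hs
      rw [add_sub_cancel_left] at this
      exact mul_le_mul_of_nonneg_left this hL
    have := (convex_uIcc t (t + r)).norm_image_sub_le_of_norm_hasDerivWithin_le hd hb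
      left_mem_uIcc right_mem_uIcc
    have e : (φ (t + r, x) - (t + r - t) • φ' (t, x)) - (φ (t, x) - (t - t) • φ' (t, x)) =
        φ (t + r, x) - φ (t, x) - r • φ' (t, x) := by
      simp
      ring
    rw [e] at this
    change ‖φ (t + r, x) - φ (t, x) - r • φ' (t, x)‖ ≤ _
    refine this.trans (le_of_eq ?_)
    rw [add_sub_cancel_left, Real.norm_eq_abs, mul_assoc, abs_mul_abs_self, sq]
  · have h0 : φ' (t, x) = 0 := by
      have : (fun s => φ (s, x)) = fun _ => 0 := funext fun s => slice_eq_zero hx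
      have h1 := hasDerivAt_time hφ' t x
      rw [this] at h1
      exact h1.unique (hasDerivAt_const t 0)
    change φ (t + r, x) - φ (t, x) - r • φ' (t, x) = 0
    rw [slice_eq_zero hx, slice_eq_zero hx, h0]
    simp
  · rw [Real.norm_eq_abs, abs_of_nonneg (sq_nonneg r)]
    ring

theorem lineDeriv_slice {φ : ℝ × E → ℂ} (hφ : HasCompactSupport φ) (hφ' : ContDiff ℝ ∞ φ)
    (t : ℝ) (m : E) :
    LineDeriv.lineDerivOp m (slice hφ hφ' t) =
      slice (hasCompactSupport_fderiv_apply hφ (0, m)) (contDiff_fderiv_apply hφ' (0, m)) t := by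
  ext x
  rw [lineDerivOp_apply_eq_fderiv, slice_apply]
  have h1 : HasFDerivAt φ (fderiv ℝ φ (t, x)) (t, x) :=
    (hφ'.differentiable (by simp) _).hasFDerivAt
  have h2 : HasFDerivAt (fun y => φ (t, y))
      ((fderiv ℝ φ (t, x)).comp (ContinuousLinearMap.inr ℝ ℝ E)) x :=
    h1.comp x (hasFDerivAt_prodMk_right t x)
  change fderiv ℝ (fun y => φ (t, y)) x m = _
  rw [h2.fderiv]
  simp

theorem continuous_toSq_laplacian_slice {φ : ℝ × E → ℂ} (hφ : HasCompactSupport φ)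
    (hφ' : ContDiff ℝ ∞ φ) : Continuous fun t => toSq (Δ (slice hφ hφ' t)) := by
  simp_rw [laplacian_eq_sum (stdOrthonormalBasis ℝ E), lineDeriv_slice, map_sum]
  exact continuous_finsetSum _ fun i _ => continuous_toSq_slice _ _

end

/-! ### Mild solutions are distributional solutions -/

section

open scoped ComplexConjugate ContDiff

variable {E : Type*} [NormedAddCommGroup E] [InnerProductSpace ℝ E] [FiniteDimensional ℝ E]
  [MeasurableSpace E] [BorelSpace E]

theorem hasCompactSupport_conj {φ : ℝ × E → ℂ} (hφ : HasCompactSupport φ) :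
    HasCompactSupport fun p => conj (φ p) :=
  hφ.comp_left (map_zero _)

theorem contDiff_conj {φ : ℝ × E → ℂ} (hφ' : ContDiff ℝ ∞ φ) :
    ContDiff ℝ ∞ fun p => conj (φ p) :=
  Complex.conjCLE.contDiff.comp hφ'

/-- The distributional pairing is bilinear while the inner product is conjugate linear in its first
slot, so the conjugate test function appears. -/
theorem integral_mul_deriv_time {φ : ℝ × E → ℂ} (hφ : HasCompactSupport φ)
    (hφ' : ContDiff ℝ ∞ φ) (u : SqInt E) (t : ℝ) :
    ∫ x, u x * (-Complex.I * deriv (fun s => φ (s, x)) t) =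
      -Complex.I * inner ℂ (toSq (slice
        (hasCompactSupport_fderiv_apply (hasCompactSupport_conj hφ) (1, 0))
        (contDiff_fderiv_apply (contDiff_conj hφ') (1, 0)) t)) u := by
  rw [inner_toSq, ← integral_const_mul]
  congr 1
  funext x
  have h1 := (hasDerivAt_time (contDiff_conj hφ') t x).deriv
  have h2 : deriv (fun s => conj (φ (s, x))) t = conj (deriv (fun s => φ (s, x)) t) := deriv.star ..
  rw [slice_apply, ← h1, h2, Complex.conj_conj]
  ring

theorem integral_mul_schrodinger {φ : ℝ × E → ℂ} (hφ : HasCompactSupport φ)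
    (hφ' : ContDiff ℝ ∞ φ) {V : E → ℂ} (hV : MemLp V ⊤ volume) (u : SqInt E) (t : ℝ) :
    ∫ x, u x * (-(Δ (fun y => φ (t, y)) x) + V x * φ (t, x)) =
      -inner ℂ (toSq (Δ (slice (hasCompactSupport_conj hφ) (contDiff_conj hφ') t))) u +
        inner ℂ (toSq (slice (hasCompactSupport_conj hφ) (contDiff_conj hφ') t))
          (mulOp hV.toLp u) := by
  set g := slice (hasCompactSupport_conj hφ) (contDiff_conj hφ') t with hg
  rw [inner_toSq, inner_toSq, ← integral_neg, ← integral_add (integrable_mul_conj _ _).fun_neg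
    (integrable_mul_conj _ _)]
  apply integral_congr_ae
  filter_upwards [coeFn_mulOp_toLp hV u] with x hx
  rw [hx]
  have h1 : Δ g x = conj (Δ (fun y => φ (t, y)) x) := by
    rw [laplacian_apply]
    exact congrFun (InnerProductSpace.laplacian_CLE_comp_left (l := Complex.conjCLE)
      (f := fun y => φ (t, y))) x
  have h2 : g x = conj (φ (t, x)) := rfl
  rw [h1, h2, Complex.conj_conj, Complex.conj_conj]
  ring

/-- A product rule for a group that is only strongly continuous: the orbit is differentiable because
`G t` is Schwartz, and the increment of `G` is handled by joint continuity. -/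
theorem hasDerivAt_freeProp_neg_apply {G : ℝ → SqInt E} {G' : SqInt E} {g : 𝓢(E, ℂ)} {t : ℝ}
    (hG : HasDerivAt G G' t) (hg : G t = toSq g) :
    HasDerivAt (fun s => freeProp (-s) (G s))
      (freeProp (-t) (G' - toSq (Complex.I • (Δ g)))) t := by
  have h1 : HasDerivAt (fun s => freeProp (-s) (G t)) (-freeProp (-t) (toSq (Complex.I • (Δ g)))) t := by
    rw [hg]
    have h := (hasDerivAt_freeProp_toSq g (-t)).scomp t (hasDerivAt_neg t)
    rwa [neg_one_smul] at h
  rw [hasDerivAt_iff_tendsto_slope_zero] at hG h1 ⊢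
  have h2 : Tendsto (fun h : ℝ => -(t + h)) (𝓝[≠] 0) (𝓝 (-t)) := by
    have : Tendsto (fun h : ℝ => -(t + h)) (𝓝 0) (𝓝 (-(t + 0))) :=
      (by fun_prop : Continuous fun h : ℝ => -(t + h)).tendsto 0
    rw [add_zero] at this
    exact this.mono_left nhdsWithin_le_nhds
  have h3 := (tendsto_freeProp_apply h2 hG).add h1
  rw [map_sub, sub_eq_add_neg]
  refine h3.congr fun h => ?_
  rw [ContinuousLinearMap.map_smul_of_tower, ← smul_add, map_sub]
  congr 1
  abel

/-- Let v(t) = e^{-itΔ} u(t), which is differentiable by Duhamel. The pairing of e^{-itΔ} ψ(t) with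
v(t) vanishes at both ends, so its derivative has integral zero; unitarity turns that derivative
into `I` times the difference of the two integrands. -/
theorem IsMildSolution.weak {T : ℝ} (hT : 0 ≤ T) {V : SqInt E →L[ℂ] SqInt E} {f : SqInt E}
    {u : ℝ → SqInt E} (hu : IsMildSolution T V f u) {ψ : ℝ × E → ℂ} (hψ : HasCompactSupport ψ)
    (hψ' : ContDiff ℝ ∞ ψ) (h0 : ∀ x, ψ (0, x) = 0) (h1 : ∀ x, ψ (T, x) = 0) :
    ∫ t in (0 : ℝ)..T, -Complex.I * inner ℂ (toSq (slice
        (hasCompactSupport_fderiv_apply hψ (1, 0)) (contDiff_fderiv_apply hψ' (1, 0)) t)) (u t) =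
      ∫ t in (0 : ℝ)..T, (-inner ℂ (toSq (Δ (slice hψ hψ' t))) (u t) +
        inner ℂ (toSq (slice hψ hψ' t)) (V (u t))) := by
  set G := fun t => toSq (slice hψ hψ' t) with hG
  set G' := fun t => toSq (slice
    (hasCompactSupport_fderiv_apply hψ (1, 0)) (contDiff_fderiv_apply hψ' (1, 0)) t) with hG'
  set L := fun t => toSq (Δ (slice hψ hψ' t)) with hL
  have cu := hu.continuous
  have cG : Continuous G := continuous_toSq_slice _ _
  have cG' : Continuous G' := continuous_toSq_slice _ _
  have cL : Continuous L := continuous_toSq_laplacian_slice _ _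
  set B := fun s => (-Complex.I) • freeProp (-s) (V (u s)) with hB
  have cB : Continuous B := (continuous_freeProp continuous_neg
    (V.continuous.comp cu)).const_smul (-Complex.I)
  set v := fun t => f + ∫ s in (0 : ℝ)..t, B s with hv
  have dv : ∀ t, HasDerivAt v (B t) t := fun t =>
    (intervalIntegral.integral_hasDerivAt_right (cB.intervalIntegrable _ _)
      (cB.stronglyMeasurableAtFilter _ _) cB.continuousAt).const_add f
  have uv : ∀ t ∈ Icc 0 T, u t = freeProp t (v t) := hu.duhamel
  have dF : ∀ t, HasDerivAt (fun t => inner ℂ (freeProp (-t) (G t)) (v t))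
      (inner ℂ (freeProp (-t) (G t)) (B t) +
        inner ℂ (freeProp (-t) (G' t - toSq (Complex.I • (Δ (slice hψ hψ' t))))) (v t)) t :=
    fun t => (hasDerivAt_freeProp_neg_apply (hasDerivAt_toSq_slice hψ hψ' t) rfl).inner ℂ (dv t)
  have eF : ∀ t ∈ Icc 0 T, inner ℂ (freeProp (-t) (G t)) (B t) +
      inner ℂ (freeProp (-t) (G' t - toSq (Complex.I • (Δ (slice hψ hψ' t))))) (v t) =
      Complex.I * ((-Complex.I * inner ℂ (G' t) (u t)) -
        (-inner ℂ (L t) (u t) + inner ℂ (G t) (V (u t)))) := by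
    intro t ht
    rw [inner_freeProp_left (-t) _ (v t), neg_neg, ← uv t ht, hB]
    simp only
    rw [inner_smul_right, inner_freeProp_freeProp, inner_sub_left, map_smul, inner_smul_left]
    simp only [Complex.conj_I]
    change _ = Complex.I * ((-Complex.I * inner ℂ (G' t) (u t)) -
        (-inner ℂ (toSq (Δ (slice hψ hψ' t))) (u t) + inner ℂ (G t) (V (u t))))
    linear_combination (inner ℂ (G' t) (u t)) * Complex.I_sq
  have c1 : Continuous fun t => -Complex.I * inner ℂ (G' t) (u t) :=
    continuous_const.mul (cG'.inner cu)
  have c2 : Continuous fun t => -inner ℂ (L t) (u t) + inner ℂ (G t) (V (u t)) :=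
    (cL.inner cu).neg.add (cG.inner (V.continuous.comp cu))
  have key := intervalIntegral.integral_eq_sub_of_hasDerivAt_of_le hT
    (fun t _ => (dF t).continuousAt.continuousWithinAt)
    (f' := fun t => Complex.I * ((-Complex.I * inner ℂ (G' t) (u t)) -
        (-inner ℂ (L t) (u t) + inner ℂ (G t) (V (u t)))))
    (fun t ht => by rw [← eF t (Ioo_subset_Icc_self ht)]; exact dF t)
    ((continuous_const.mul (c1.sub c2)).intervalIntegrable _ _)
  have z : ∀ t, (∀ x, ψ (t, x) = 0) → G t = 0 := by
    intro t h
    have : slice hψ hψ' t = 0 := by ext x; exact h x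
    rw [hG]
    simp only
    rw [this, map_zero]
  rw [z T h1, z 0 h0, map_zero, map_zero, inner_zero_left, inner_zero_left, sub_zero,
    intervalIntegral.integral_const_mul, mul_eq_zero, or_iff_right Complex.I_ne_zero,
    intervalIntegral.integral_sub (c1.intervalIntegrable _ _) (c2.intervalIntegrable _ _),
    sub_eq_zero] at key
  exact key

theorem IsMildSolution.isPhysicalSolution {n : ℕ} {T : ℝ} (hT : 0 ≤ T)
    {V : EuclideanSpace ℝ (Fin n) → ℂ} (hV : MemLp V ⊤ volume) {f : L2 n} {u : ℝ → L2 n}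
    (hu : IsMildSolution T (mulOp hV.toLp) f u) : IsPhysicalSolution T V f u where
  continuousOn := hu.continuous.continuousOn
  equation φ := by
    have hφ := φ.hasCompactSupport
    have hφ' : ContDiff ℝ ∞ φ := φ.contDiff
    simp_rw [integral_mul_deriv_time hφ hφ', integral_mul_schrodinger hφ hφ' hV]
    have hz : ∀ t x, t ∉ Ioo 0 T → φ (t, x) = 0 := by
      intro t x ht
      by_contra h
      exact ht (φ.tsupport_subset (subset_tsupport _ h)).1
    refine hu.weak hT _ _ (fun x => ?_) (fun x => ?_)
    · rw [hz 0 x (by simp), map_zero]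
    · rw [hz T x (by simp), map_zero]
  initial := by
    rw [hu.duhamel 0 ⟨le_rfl, hT⟩]
    simp

end

/-! ### Enlarging the class of test functions; the du Bois-Reymond lemma -/

section

open scoped ComplexConjugate ContDiff

variable {E : Type*} [NormedAddCommGroup E] [InnerProductSpace ℝ E] [FiniteDimensional ℝ E]
  [MeasurableSpace E] [BorelSpace E]

theorem norm_laplacian_le (f : E → ℂ) (x : E) :
    ‖Δ f x‖ ≤ Module.finrank ℝ E * ‖iteratedFDeriv ℝ 2 f x‖ := by
  rw [InnerProductSpace.laplacian_eq_iteratedFDeriv_orthonormalBasis f (stdOrthonormalBasis ℝ E)]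
  refine (norm_sum_le _ _).trans ?_
  refine (Finset.sum_le_card_nsmul _ _ ‖iteratedFDeriv ℝ 2 f x‖ fun i _ => ?_).trans (by simp)
  refine ((iteratedFDeriv ℝ 2 f x).le_opNorm _).trans (le_of_eq ?_)
  simp [Fin.prod_univ_two]

theorem memLp_iteratedFDeriv_norm (g : 𝓢(E, ℂ)) (i : ℕ) (hi : i ≤ 2) :
    MemLp (fun x => ‖iteratedFDeriv ℝ i g x‖) 2 volume := by
  interval_cases i
  · simpa using (g.memLp 2).norm
  · simpa [norm_iteratedFDeriv_one] using ((fderivCLM ℝ E ℂ g).memLp 2).norm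
  · have h := ((fderivCLM ℝ E (E →L[ℝ] ℂ) (fderivCLM ℝ E ℂ g)).memLp 2).norm
    refine h.congr_norm ?_ (Eventually.of_forall fun x => ?_)
    · exact (g.smooth 2).continuous_iteratedFDeriv'.norm.aestronglyMeasurable
    · have e : ((fderivCLM ℝ E ℂ g : 𝓢(E, E →L[ℝ] ℂ)) : E → E →L[ℝ] ℂ) = fderiv ℝ g := by
        funext y
        simp
      rw [fderivCLM_apply, e, ← norm_iteratedFDeriv_one, norm_iteratedFDeriv_fderiv]

theorem norm_iteratedFDeriv_comp_smul_le {η : E → ℝ} (hη : ContDiff ℝ ∞ η) {c : ℝ}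
    (hc0 : 0 ≤ c) (hc1 : c ≤ 1) (i : ℕ) (x : E) :
    ‖iteratedFDeriv ℝ i (fun y => η (c • y)) x‖ ≤ ‖iteratedFDeriv ℝ i η (c • x)‖ := by
  have h := (c • ContinuousLinearMap.id ℝ E).iteratedFDeriv_comp_right hη x (i := i)
    (by exact_mod_cast le_top)
  change iteratedFDeriv ℝ i (fun y => η (c • y)) x = _ at h
  rw [h]
  refine (ContinuousMultilinearMap.norm_compContinuousLinearMap_le _ _).trans ?_
  have h1 : ‖c • ContinuousLinearMap.id ℝ E‖ ≤ 1 := by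
    rw [norm_smul, Real.norm_eq_abs, abs_of_nonneg hc0]
    exact mul_le_one₀ hc1 (norm_nonneg _) ContinuousLinearMap.norm_id_le
  refine mul_le_of_le_one_right (norm_nonneg _) ?_
  exact Finset.prod_le_one (fun _ _ => norm_nonneg _) fun _ _ => h1

/-- Cut `g` off by the dilated bumps η(x/(k+1)) and pass to the limit by dominated convergence. The
extension matters because e^{isΔ} destroys compact support but preserves the Schwartz class. -/
theorem inner_toSq_eq_of_compactSupport {A B : SqInt E}
    (h : ∀ (g : E → ℂ) (hc : HasCompactSupport g) (hs : ContDiff ℝ ∞ g),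
      inner ℂ (toSq (hc.toSchwartzMap hs)) A = inner ℂ (toSq (Δ (hc.toSchwartzMap hs))) B)
    (g : 𝓢(E, ℂ)) : inner ℂ (toSq g) A = inner ℂ (toSq (Δ g)) B := by
  let η : ContDiffBump (0 : E) := ⟨1, 2, one_pos, one_lt_two⟩
  have hη : ContDiff ℝ ∞ η := η.contDiff
  let S := η.hasCompactSupport.toSchwartzMap hη
  have hS : ∀ i, ∃ C, 0 < C ∧ ∀ x, ‖iteratedFDeriv ℝ i η x‖ ≤ C := by
    intro i
    obtain ⟨C, hC, hb⟩ := S.decay 0 i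
    exact ⟨C, hC, fun x => by
      have := hb x
      rw [pow_zero, one_mul] at this
      exact this⟩
  choose C hC hCb using hS
  let c : ℕ → ℝ := fun k => 1 / ((k : ℝ) + 1)
  have hc0 : ∀ k, 0 < c k := fun k => Nat.one_div_pos_of_nat
  have hc1 : ∀ k, c k ≤ 1 := fun k => by
    simp only [c]
    rw [div_le_one (by positivity)]
    linarith [(Nat.cast_nonneg k : (0 : ℝ) ≤ k)]
  have hct : Tendsto c atTop (𝓝 0) := tendsto_one_div_add_atTop_nhds_zero_nat
  let ηk : ℕ → E → ℝ := fun k x => η (c k • x)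
  have hηk : ∀ k, ContDiff ℝ ∞ (ηk k) := fun k => hη.comp (contDiff_const_smul (c k))
  have hηc : ∀ k, HasCompactSupport (ηk k) := fun k =>
    η.hasCompactSupport.comp_smul (hc0 k).ne'
  let gk : ℕ → E → ℂ := fun k x => ηk k x • g x
  have hgs : ∀ k, ContDiff ℝ ∞ (gk k) := fun k => (hηk k).smul (g.smooth ⊤)
  have hgc : ∀ k, HasCompactSupport (gk k) := fun k => (hηc k).smul_right
  -- Equality on a neighbourhood, not just at `x`, makes the Laplacians agree as well.
  have hev : ∀ x, ∀ᶠ k in atTop, gk k =ᶠ[𝓝 x] g := by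
    intro x
    have h1 : Tendsto (fun k => c k * (‖x‖ + 1)) atTop (𝓝 0) := by
      simpa using hct.mul_const (‖x‖ + 1)
    filter_upwards [h1.eventually (gt_mem_nhds one_pos)] with k hk
    filter_upwards [Metric.ball_mem_nhds x one_pos] with y hy
    have h2 : c k • y ∈ Metric.closedBall (0 : E) η.rIn := by
      rw [mem_closedBall_zero_iff, norm_smul, Real.norm_eq_abs, abs_of_pos (hc0 k)]
      change _ ≤ (1 : ℝ)
      have h3 : ‖y‖ ≤ ‖x‖ + 1 := by
        have := norm_le_norm_add_norm_sub' y x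
        rw [mem_ball_iff_norm] at hy
        linarith
      nlinarith [hc0 k]
    simp only [gk, ηk]
    rw [η.one_of_mem_closedBall h2, one_smul]
  -- The Leibniz bound for two derivatives of the product. It is uniform in `k` because dilation by
  -- a factor `c k ≤ 1` does not increase the derivatives of η.
  let bd : E → ℝ := fun x => ∑ i ∈ Finset.range 3,
    ((2 : ℕ).choose i : ℝ) * C i * ‖iteratedFDeriv ℝ (2 - i) g x‖
  have hbd : MemLp bd 2 volume := memLp_finsetSum _ fun i _ =>
    (memLp_iteratedFDeriv_norm g (2 - i) (by omega)).const_mul _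
  have hlap : ∀ k x, ‖Δ (gk k) x‖ ≤ Module.finrank ℝ E * bd x := by
    intro k x
    have hle : ∀ i : ℕ, (i : ℕ∞ω) ≤ ((⊤ : ℕ∞) : ℕ∞ω) := fun i => by exact_mod_cast le_top
    refine (norm_laplacian_le _ _).trans ?_
    gcongr
    refine (norm_iteratedFDeriv_smul_le (hηk k) (g.smooth ⊤) x (n := 2)
      (hle 2)).trans ?_
    simp only [bd]
    gcongr with i
    exact (norm_iteratedFDeriv_comp_smul_le hη (hc0 k).le (hc1 k) i x).trans (hCb i _)
  have t1 : Tendsto (fun k => inner ℂ (toSq ((hgc k).toSchwartzMap (hgs k))) A) atTop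
      (𝓝 (inner ℂ (toSq g) A)) := by
    simp_rw [inner_toSq]
    refine tendsto_integral_of_dominated_convergence (fun x => ‖A x * conj (g x)‖)
      (fun k => (integrable_mul_conj _ A).aestronglyMeasurable) (integrable_mul_conj g A).norm
      (fun k => Eventually.of_forall fun x => ?_) (Eventually.of_forall fun x => ?_)
    · change ‖A x * conj (ηk k x • g x)‖ ≤ _
      rw [norm_mul, norm_mul, RCLike.norm_conj, RCLike.norm_conj, norm_smul]
      have h1 : ‖ηk k x‖ ≤ 1 := by
        rw [Real.norm_eq_abs, abs_of_nonneg η.nonneg]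
        exact η.le_one
      gcongr
      exact mul_le_of_le_one_left (norm_nonneg _) h1
    · refine tendsto_const_nhds.congr' ?_
      filter_upwards [hev x] with k hk
      change _ = A x * conj (gk k x)
      rw [hk.self_of_nhds]
  have t2 : Tendsto (fun k => inner ℂ (toSq (Δ ((hgc k).toSchwartzMap (hgs k)))) B) atTop
      (𝓝 (inner ℂ (toSq (Δ g)) B)) := by
    simp_rw [inner_toSq, laplacian_apply]
    refine tendsto_integral_of_dominated_convergence
      (fun x => ‖B x‖ * (Module.finrank ℝ E * bd x))
      (fun k => ?_) ((Lp.memLp B).norm.integrable_mul (hbd.const_mul _))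
      (fun k => Eventually.of_forall fun x => ?_) (Eventually.of_forall fun x => ?_)
    · have := (integrable_mul_conj (Δ ((hgc k).toSchwartzMap (hgs k))) B).aestronglyMeasurable
      simpa only [laplacian_apply] using this
    · rw [norm_mul, RCLike.norm_conj]
      exact mul_le_mul_of_nonneg_left (hlap k x) (norm_nonneg _)
    · refine tendsto_const_nhds.congr' ?_
      filter_upwards [hev x] with k hk
      change _ = B x * conj (Δ (gk k) x)
      rw [(InnerProductSpace.laplacian_congr_nhds hk).self_of_nhds]
  refine tendsto_nhds_unique t1 ?_
  simp_rw [h _ (hgc _) (hgs _)]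
  exact t2

/-- The derivative of a mollification of `P` at `x` is, up to sign, the integral of `P` against the
derivative of a bump around `x`. The mollifications are thus constant away from the endpoints, and
so is their limit `P`; continuity reaches the endpoints. -/
theorem eq_of_integral_deriv_smul_eq_zero {P : ℝ → ℂ} (hP : Continuous P) {T : ℝ} (hT : 0 < T)
    (h : ∀ χ : ℝ → ℝ, ContDiff ℝ ∞ χ → HasCompactSupport χ → tsupport χ ⊆ Ioo 0 T →
      ∫ t in (0 : ℝ)..T, deriv χ t • P t = 0) {t : ℝ} (ht : t ∈ Icc 0 T) : P t = P 0 := by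
  let b : ℕ → ContDiffBump (0 : ℝ) := fun k =>
    ⟨1 / ((k : ℝ) + 1) / 2, 1 / ((k : ℝ) + 1), by positivity, half_lt_self (by positivity)⟩
  have hb : Tendsto (fun k => (b k).rOut) atTop (𝓝 0) := tendsto_one_div_add_atTop_nhds_zero_nat
  let L := ContinuousLinearMap.lsmul ℝ ℝ (E := ℂ)
  let Q : ℕ → ℝ → ℂ := fun k => convolution ((b k).normed volume) P L volume
  have hQ : ∀ x, Tendsto (fun k => Q k x) atTop (𝓝 (P x)) := fun x =>
    ContDiffBump.convolution_tendsto_right_of_continuous hb hP x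
  have hd : ∀ k x, (b k).rOut < x → x < T - (b k).rOut → HasDerivAt (Q k) 0 x := by
    intro k x hx1 hx2
    set ρ := (b k).normed volume with hρ
    have hρs : ContDiff ℝ ∞ ρ := (b k).contDiff_normed
    have hρc : HasCompactSupport ρ := (b k).hasCompactSupport_normed
    have h1 := hρc.hasDerivAt_convolution_left L (hρs.of_le (by simp)) (hP.locallyIntegrable (μ := volume)) x
    have h2 : convolution (deriv ρ) P L volume x = 0 := by
      rw [convolution_lsmul_swap]
      set χ : ℝ → ℝ := fun s => ρ (x - s) with hχ
      have hχs : ContDiff ℝ ∞ χ := hρs.comp (contDiff_const.sub contDiff_id)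
      have hχt : tsupport χ ⊆ Metric.closedBall x (b k).rOut := by
        refine closure_minimal (fun s hs => ?_) Metric.isClosed_closedBall
        have : x - s ∈ Function.support ρ := hs
        rw [hρ, (b k).support_normed_eq, mem_ball_zero_iff] at this
        rw [mem_closedBall_iff_norm']
        exact this.le
      have hχi : tsupport χ ⊆ Ioo 0 T := by
        refine hχt.trans fun s hs => ?_
        rw [mem_closedBall_iff_norm, Real.norm_eq_abs, abs_le] at hs
        exact ⟨by linarith [hs.1], by linarith [hs.2]⟩
      have hχd : ∀ s, deriv χ s = -deriv ρ (x - s) := fun s => by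
        simp only [hχ]
        rw [deriv_comp_const_sub]
      have hz := h χ hχs (HasCompactSupport.of_support_subset_isCompact (isCompact_closedBall x _)
        ((subset_tsupport _).trans hχt)) hχi
      rw [intervalIntegral.integral_eq_integral_of_support_subset] at hz
      · simp_rw [hχd, neg_smul] at hz
        rw [integral_neg, neg_eq_zero] at hz
        exact hz
      · intro s hs
        have h3 : s ∈ Function.support (deriv χ) := fun h0 => hs (by simp [h0])
        exact Ioo_subset_Ioc_self (hχi (support_deriv_subset h3))
    rwa [h2] at h1
  have hc : ∀ x y, 0 < x → x ≤ y → y < T → P y = P x := by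
    intro x y hx hxy hy
    refine tendsto_nhds_unique ((hQ y).congr' ?_) (hQ x)
    filter_upwards [hb.eventually (gt_mem_nhds hx),
      hb.eventually (gt_mem_nhds (sub_pos.2 hy))] with k h1 h2
    have hd' : ∀ z ∈ Icc x y, HasDerivAt (Q k) 0 z := fun z hz =>
      hd k z (h1.trans_le hz.1) (by linarith [hz.2])
    exact constant_of_has_deriv_right_zero (fun z hz => (hd' z hz).continuousAt.continuousWithinAt)
      (fun z hz => (hd' z (Ico_subset_Icc_self hz)).hasDerivWithinAt) y ⟨hxy, le_rfl⟩
  have hcl : IsClosed {s | P s = P (T / 2)} := isClosed_eq hP continuous_const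
  have hsub : Icc 0 T ⊆ {s | P s = P (T / 2)} := by
    rw [← closure_Ioo hT.ne]
    refine closure_minimal (fun s hs => ?_) hcl
    rcases le_total s (T / 2) with hs' | hs'
    · exact (hc s (T / 2) hs.1 hs' (by linarith)).symm
    · exact hc (T / 2) s (by linarith) hs' hs.2
  have e1 : P t = P (T / 2) := hsub ht
  have e2 : P 0 = P (T / 2) := hsub ⟨le_rfl, hT.le⟩
  rw [e1, e2]

end

/-! ### Distributional solutions are mild solutions -/

section

open scoped ComplexConjugate ContDiff

variable {E : Type*} [NormedAddCommGroup E] [InnerProductSpace ℝ E] [FiniteDimensional ℝ E]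
  [MeasurableSpace E] [BorelSpace E]

/-- The test functions χ(t) conj(g(x)) separate the variables. After an integration by parts in
time, the du Bois-Reymond lemma applies to -i⟨g, w(t)⟩ plus the primitive of the remaining terms. -/
theorem IsPhysicalSolution.inner_compactSupport {n : ℕ} {T : ℝ} (hT : 0 < T)
    {V : EuclideanSpace ℝ (Fin n) → ℂ} (hV : MemLp V ⊤ volume) {f : L2 n} {u w : ℝ → L2 n}
    (hu : IsPhysicalSolution T V f u) (hw : Continuous w) (huw : ∀ t ∈ Icc 0 T, w t = u t)
    {g : EuclideanSpace ℝ (Fin n) → ℂ} (hc : HasCompactSupport g) (hs : ContDiff ℝ ∞ g)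
    {t : ℝ} (ht : t ∈ Icc 0 T) :
    inner ℂ (toSq (hc.toSchwartzMap hs)) (w t) = inner ℂ (toSq (hc.toSchwartzMap hs)) f -
      Complex.I * ∫ s in (0 : ℝ)..t, (-inner ℂ (toSq (Δ (hc.toSchwartzMap hs))) (w s) +
        inner ℂ (toSq (hc.toSchwartzMap hs)) (mulOp hV.toLp (w s))) := by
  set S := hc.toSchwartzMap hs with hS
  set q : ℝ → ℂ := fun s => -inner ℂ (toSq (Δ S)) (w s) + inner ℂ (toSq S) (mulOp hV.toLp (w s))
    with hq
  have cq : Continuous q := (continuous_const.inner hw).neg.add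
    (continuous_const.inner ((mulOp hV.toLp).continuous.comp hw))
  have cp : Continuous fun t => inner ℂ (toSq S) (w t) := continuous_const.inner hw
  set Q : ℝ → ℂ := fun t => ∫ s in (0 : ℝ)..t, q s with hQ
  have dQ : ∀ t, HasDerivAt Q (q t) t := fun t =>
    intervalIntegral.integral_hasDerivAt_right (cq.intervalIntegrable _ _)
      (cq.stronglyMeasurableAtFilter _ _) cq.continuousAt
  have cQ : Continuous Q := continuous_iff_continuousAt.2 fun t => (dQ t).continuousAt
  have key := eq_of_integral_deriv_smul_eq_zero (P := fun t => -Complex.I * inner ℂ (toSq S) (w t)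
    + Q t) ((continuous_const.mul cp).add cQ) hT ?_ ht
  · have e1 := huw 0 ⟨le_rfl, hT.le⟩
    rw [hu.initial] at e1
    simp only [e1, hQ, intervalIntegral.integral_same, add_zero] at key
    linear_combination Complex.I * key + (inner ℂ (toSq S) (w t) - inner ℂ (toSq S) f) * Complex.I_sq
  intro χ hχs hχc hχt
  have cχ : Continuous χ := hχs.continuous
  have dχ : ∀ t, HasDerivAt χ (deriv χ t) t := fun t => (hχs.differentiable (by simp) t).hasDerivAt
  have cχ' : Continuous (deriv χ) := hχs.continuous_deriv (by simp)
  let φf : ℝ × EuclideanSpace ℝ (Fin n) → ℂ := fun p => (χ p.1 : ℂ) * conj (g p.2)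
  have hφs : ContDiff ℝ ∞ φf :=
    (Complex.ofRealCLM.contDiff.comp (hχs.comp contDiff_fst)).mul
      (Complex.conjCLE.contDiff.comp (hs.comp contDiff_snd))
  have hφsub : Function.support φf ⊆ tsupport χ ×ˢ tsupport g := by
    intro p hp
    refine ⟨subset_tsupport _ fun h => hp ?_, subset_tsupport _ fun h => hp ?_⟩
    · simp only [φf]; rw [h]; simp
    · simp only [φf]; rw [h]; simp
  have hφc : HasCompactSupport φf :=
    HasCompactSupport.of_support_subset_isCompact (hχc.isCompact.prod hc.isCompact) hφsub
  have hφt : tsupport φf ⊆ timeSlab n T := by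
    refine (closure_minimal hφsub ((isClosed_tsupport _).prod (isClosed_tsupport _))).trans ?_
    exact prod_mono hχt (subset_univ _)
  let φ : 𝓓(timeSlab n T, ℂ) := ⟨φf, hφs, hφc, hφt⟩
  have e1 := hu.equation φ
  have hφf : (φ : ℝ × EuclideanSpace ℝ (Fin n) → ℂ) = φf := rfl
  rw [hφf] at e1
  simp_rw [integral_mul_deriv_time hφc hφs, integral_mul_schrodinger hφc hφs hV] at e1
  have s1 : ∀ t, slice (hasCompactSupport_conj hφc) (contDiff_conj hφs) t = (χ t : ℂ) • S := by
    intro t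
    ext x
    change conj ((χ t : ℂ) * conj (g x)) = (χ t : ℂ) * g x
    simp
  have s2 : ∀ t, slice (hasCompactSupport_fderiv_apply (hasCompactSupport_conj hφc) (1, 0))
      (contDiff_fderiv_apply (contDiff_conj hφs) (1, 0)) t = ((deriv χ t : ℝ) : ℂ) • S := by
    intro t
    ext x
    rw [slice_apply]
    change _ = ((deriv χ t : ℝ) : ℂ) * g x
    refine (hasDerivAt_time (contDiff_conj hφs) t x).unique ?_
    have : (fun s => conj (φf (s, x))) = fun s => (χ s : ℂ) * g x := by
      funext s
      change conj ((χ s : ℂ) * conj (g x)) = _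
      simp
    rw [this]
    exact (dχ t).ofReal_comp.mul_const _
  have s3 : ∀ t, Δ ((χ t : ℂ) • S) = (χ t : ℂ) • Δ S := by
    intro t
    simp only [← laplacianCLM_eq ℂ, map_smul]
  simp_rw [s1, s2, s3, map_smul, inner_smul_left, Complex.conj_ofReal] at e1
  have e2 : ∫ t in (0 : ℝ)..T, ((deriv χ t : ℝ) : ℂ) * (-Complex.I * inner ℂ (toSq S) (w t)) =
      ∫ t in (0 : ℝ)..T, (χ t : ℂ) * q t := by
    refine Eq.trans ?_ (e1.trans ?_)
    · refine intervalIntegral.integral_congr fun t ht => ?_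
      rw [uIcc_of_le hT.le] at ht
      rw [huw t ht]
      ring
    · refine intervalIntegral.integral_congr fun t ht => ?_
      rw [uIcc_of_le hT.le] at ht
      simp only [hq]
      rw [huw t ht]
      ring
  have cχc : Continuous fun t => (χ t : ℂ) := Complex.continuous_ofReal.comp cχ
  have cχc' : Continuous fun t => ((deriv χ t : ℝ) : ℂ) := Complex.continuous_ofReal.comp cχ'
  have e3 := intervalIntegral.integral_mul_deriv_eq_deriv_mul (a := 0) (b := T)
    (u := fun t => (χ t : ℂ)) (v := Q) (u' := fun t => ((deriv χ t : ℝ) : ℂ)) (v' := q)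
    (fun t _ => (dχ t).ofReal_comp) (fun t _ => dQ t) (cχc'.intervalIntegrable _ _)
    (cq.intervalIntegrable _ _)
  have z0 : χ 0 = 0 := image_eq_zero_of_notMem_tsupport fun h => (hχt h).1.false
  have zT : χ T = 0 := image_eq_zero_of_notMem_tsupport fun h => (hχt h).2.false
  simp only [z0, zT, Complex.ofReal_zero, zero_mul, sub_zero, zero_sub] at e3
  simp only [Complex.real_smul, mul_add]
  rw [intervalIntegral.integral_add, e2, e3, neg_add_cancel]
  · exact (cχc'.mul (continuous_const.mul cp)).intervalIntegrable _ _
  · exact (cχc'.mul cQ).intervalIntegrable _ _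

theorem inner_interval_integral {a b : ℝ} (x : SqInt E) {w : ℝ → SqInt E} (hw : Continuous w) :
    ∫ s in a..b, inner ℂ x (w s) = inner ℂ x (∫ s in a..b, w s) :=
  (innerSL ℂ x).intervalIntegral_comp_comm (hw.intervalIntegrable _ _)

/-- A product rule for `w` that need not be differentiable in norm: differentiability of its pairing
with the frozen vector `G t` suffices, since the other part of the difference quotient uses only
continuity of `w`. -/
theorem _root_.HasDerivAt.inner_of_weak {H : Type*} [NormedAddCommGroup H]
    [InnerProductSpace ℂ H] {G w : ℝ → H} {G' : H} {d : ℂ} {s : Set ℝ} {t : ℝ}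
    (hG : HasDerivAt G G' t) (hw : ContinuousWithinAt w s t)
    (hd : HasDerivWithinAt (fun r => inner ℂ (G t) (w r)) d s t) :
    HasDerivWithinAt (fun r => inner ℂ (G r) (w r)) (inner ℂ G' (w t) + d) s t := by
  rw [hasDerivWithinAt_iff_tendsto_slope] at hd ⊢
  have h1 := hasDerivWithinAt_iff_tendsto_slope.1 (hG.hasDerivWithinAt (s := s))
  have h2 : Tendsto w (𝓝[s \ {t}] t) (𝓝 (w t)) := hw.mono_left (nhdsWithin_mono _ sdiff_subset)
  refine ((h1.inner h2).add hd).congr fun r => ?_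
  simp only [slope_def_module, ← Complex.coe_smul, inner_smul_left, Complex.conj_ofReal,
    inner_sub_left, smul_eq_mul]
  ring

/-- Test the equation at time `s` against the moving function e^{isΔ} g. The Laplacian terms cancel,
so ⟨g, e^{-isΔ} u(s)⟩ has derivative ⟨g, -i e^{-isΔ} V u(s)⟩; integrating and using density of the
Schwartz functions gives Duhamel's formula. Clamping time to [0, T] makes the curve continuous on
the whole line. -/
theorem IsPhysicalSolution.isMildSolution {n : ℕ} {T : ℝ} (hT : 0 < T)
    {V : EuclideanSpace ℝ (Fin n) → ℂ} (hV : MemLp V ⊤ volume) {f : L2 n} {u : ℝ → L2 n}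
    (hu : IsPhysicalSolution T V f u) :
    IsMildSolution T (mulOp hV.toLp) f fun t => u (projIcc 0 T hT.le t) := by
  set w : ℝ → L2 n := fun t => u (projIcc 0 T hT.le t) with hw
  have cw : Continuous w :=
    (continuousOn_iff_continuous_domRestrict.1 hu.continuousOn).comp continuous_projIcc
  have huw : ∀ t ∈ Icc 0 T, w t = u t := by
    intro t ht
    simp only [hw]
    rw [projIcc_of_mem _ ht]
  have w0 : w 0 = f := (huw 0 ⟨le_rfl, hT.le⟩).trans hu.initial
  set A := mulOp hV.toLp with hA
  have cAw : Continuous fun s => A (w s) := A.continuous.comp cw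
  -- All terms paired with `g` are collected on the left and those paired with `Δ g` on the right,
  -- the form in which the cutoff lemma reaches Schwartz `g`.
  have step : ∀ t ∈ Icc 0 T, ∀ g : 𝓢(EuclideanSpace ℝ (Fin n), ℂ),
      inner ℂ (toSq g) (w t - f + Complex.I • ∫ s in (0 : ℝ)..t, A (w s)) =
        inner ℂ (toSq (Δ g)) (Complex.I • ∫ s in (0 : ℝ)..t, w s) := by
    intro t ht g
    refine inner_toSq_eq_of_compactSupport (fun g hc hs => ?_) g
    have h1 := hu.inner_compactSupport hT hV cw huw hc hs ht
    rw [intervalIntegral.integral_add] at h1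
    · rw [intervalIntegral.integral_neg, inner_interval_integral _ cw,
        inner_interval_integral _ cAw] at h1
      rw [inner_add_right, inner_sub_right, inner_smul_right, inner_smul_right, h1]
      ring
    · exact ((continuous_const.inner cw).neg : Continuous fun s => -inner ℂ _ (w s)).intervalIntegrable _ _
    · exact (continuous_const.inner cAw).intervalIntegrable _ _
  have dstep : ∀ t ∈ Icc 0 T, ∀ g : 𝓢(EuclideanSpace ℝ (Fin n), ℂ),
      HasDerivWithinAt (fun t => inner ℂ (toSq g) (w t))
        (Complex.I * inner ℂ (toSq (Δ g)) (w t) - Complex.I * inner ℂ (toSq g) (A (w t)))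
        (Icc 0 T) t := by
    intro t ht g
    have h1 : HasDerivAt (fun t => inner ℂ (toSq g) f +
        Complex.I * (∫ s in (0 : ℝ)..t, inner ℂ (toSq (Δ g)) (w s)) -
        Complex.I * ∫ s in (0 : ℝ)..t, inner ℂ (toSq g) (A (w s)))
        (Complex.I * inner ℂ (toSq (Δ g)) (w t) - Complex.I * inner ℂ (toSq g) (A (w t))) t := by
      have c1 : Continuous fun s => inner ℂ (toSq (Δ g)) (w s) := continuous_const.inner cw
      have c2 : Continuous fun s => inner ℂ (toSq g) (A (w s)) := continuous_const.inner cAw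
      exact (((intervalIntegral.integral_hasDerivAt_right (c1.intervalIntegrable _ _)
        (c1.stronglyMeasurableAtFilter _ _) c1.continuousAt).const_mul _).const_add _).sub
        ((intervalIntegral.integral_hasDerivAt_right (c2.intervalIntegrable _ _)
        (c2.stronglyMeasurableAtFilter _ _) c2.continuousAt).const_mul _)
    refine h1.hasDerivWithinAt.congr_of_mem (fun s hs => ?_) ht
    have h2 := step s hs g
    rw [inner_add_right, inner_sub_right, inner_smul_right, inner_smul_right,
      ← inner_interval_integral _ cw, ← inner_interval_integral _ cAw] at h2
    linear_combination h2
  set B := fun s => (-Complex.I) • freeProp (-s) (A (w s)) with hB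
  have cB : Continuous B := (continuous_freeProp continuous_neg cAw).const_smul (-Complex.I)
  have final : ∀ t ∈ Icc 0 T, freeProp (-t) (w t) = f + ∫ s in (0 : ℝ)..t, B s := by
    intro t ht
    rw [← sub_eq_iff_eq_add]
    refine denseRange_toSq.eq_of_inner_right ℂ fun g => ?_
    have cI : Continuous fun s => inner ℂ (toSq g) (B s) := continuous_const.inner cB
    have dk : ∀ s ∈ Icc 0 T, HasDerivWithinAt (fun s => inner ℂ (freeProp s (toSq g)) (w s) -
        ∫ r in (0 : ℝ)..s, inner ℂ (toSq g) (B r)) 0 (Icc 0 T) s := by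
      intro s hs
      have h1 := dstep s hs (schwartzProp s g)
      rw [← freeProp_toSq] at h1
      have h2 := (hasDerivAt_freeProp_toSq g s).inner_of_weak (cw.continuousWithinAt (s := Icc 0 T)) h1
      have h3 := h2.fun_sub (intervalIntegral.integral_hasDerivAt_right (cI.intervalIntegrable 0 s)
        (cI.stronglyMeasurableAtFilter _ _) cI.continuousAt).hasDerivWithinAt
      refine h3.congr_deriv ?_
      rw [laplacian_schwartzProp, ← freeProp_toSq, map_smul, map_smul, inner_smul_left,
        Complex.conj_I, hB]
      simp only
      rw [inner_smul_right, inner_freeProp_left s (toSq g) (A (w s))]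
      ring
    have hk := constant_of_has_deriv_right_zero (fun s hs => (dk s hs).continuousWithinAt)
      (fun s hs => (dk s (Ico_subset_Icc_self hs)).mono_of_mem_nhdsWithin
        (Icc_mem_nhdsGE_of_mem hs)) t ht
    rw [inner_sub_right, ← inner_interval_integral _ cB, ← inner_freeProp_left, hk]
    simp [w0]
  refine ⟨cw, fun t ht => ?_⟩
  change w t = _
  rw [← hB, ← final t ht, freeProp_freeProp_neg]

end

/-! ### First order expansion of the final state, with quadratic error -/

section

open scoped ComplexConjugate

variable {E : Type*} [NormedAddCommGroup E] [InnerProductSpace ℝ E] [FiniteDimensional ℝ E]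
  [MeasurableSpace E] [BorelSpace E]

/-- The adjoint multiplies by conj m, of the same modulus. Moving the potential onto the free wave
gains the second factor of the interaction in the remainder. -/
theorem norm_inner_mulOp_le {m : E → ℂ} (hm : MemLp m ⊤ volume) (x y : SqInt E) :
    ‖inner ℂ x (mulOp hm.toLp y)‖ ≤ ‖mulOp hm.toLp x‖ * ‖y‖ := by
  have hm' : MemLp (fun x => conj (m x)) ⊤ volume := hm.star
  have h1 : inner ℂ x (mulOp hm.toLp y) = inner ℂ (mulOp hm'.toLp x) y := by
    rw [L2.inner_def, L2.inner_def]
    apply integral_congr_ae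
    filter_upwards [coeFn_mulOp_toLp hm y, coeFn_mulOp_toLp hm' x] with a h1 h2
    rw [h1, h2]
    simp only [RCLike.inner_apply, map_mul, Complex.conj_conj]
    ring
  have h2 : ‖mulOp hm'.toLp x‖ = ‖mulOp hm.toLp x‖ := by
    rw [Lp.norm_def, Lp.norm_def]
    congr 1
    apply eLpNorm_congr_norm_ae
    filter_upwards [coeFn_mulOp_toLp hm x, coeFn_mulOp_toLp hm' x] with a h1 h2
    rw [h1, h2, norm_mul, norm_mul, RCLike.norm_conj]
  rw [h1, ← h2]
  exact norm_inner_le_norm _ _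

theorem le_exp_of_le_add_integral {r : ℝ → ℝ} (hr : Continuous r) {a C T : ℝ}
    (hC : 0 ≤ C) (ha : 0 ≤ a) (hr0 : ∀ t, 0 ≤ r t)
    (h : ∀ t ∈ Icc 0 T, r t ≤ a + C * ∫ s in (0 : ℝ)..t, r s) :
    ∀ t ∈ Icc 0 T, r t ≤ a * Real.exp (C * T) := by
  intro t ht
  set R : ℝ → ℝ := fun t => a + C * ∫ s in (0 : ℝ)..t, r s with hR
  have dR : ∀ t, HasDerivAt R (C * r t) t := fun t =>
    ((intervalIntegral.integral_hasDerivAt_right (hr.intervalIntegrable _ _)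
      (hr.stronglyMeasurableAtFilter _ _) hr.continuousAt).const_mul C).const_add a
  have hR0 : ∀ t ∈ Icc 0 T, 0 ≤ R t := fun t ht => (hr0 t).trans (h t ht)
  have key := norm_le_gronwallBound_of_norm_deriv_right_le (f := R) (f' := fun t => C * r t)
    (δ := a) (K := C) (ε := 0) (a := 0) (b := T)
    (fun t _ => (dR t).continuousAt.continuousWithinAt) (fun t _ => (dR t).hasDerivWithinAt)
    (by simp [hR, abs_of_nonneg ha])
    (fun t ht => by
      have ht' := Ico_subset_Icc_self ht
      rw [add_zero, Real.norm_eq_abs, Real.norm_eq_abs, abs_of_nonneg (mul_nonneg hC (hr0 t)),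
        abs_of_nonneg (hR0 t ht')]
      exact mul_le_mul_of_nonneg_left (h t ht') hC) t ht
  rw [gronwallBound_ε0, sub_zero] at key
  refine (h t ht).trans ((le_abs_self _).trans (key.trans ?_))
  have := ht.2
  gcongr

/-- The total strength `∫₀ᵀ ‖V e^{isΔ} f‖ ds` of the interaction of a free wave with `V`. -/
def interaction (T : ℝ) (V : SqInt E →L[ℂ] SqInt E) (f : SqInt E) : ℝ :=
  ∫ s in (0 : ℝ)..T, ‖V (freeProp s f)‖

theorem continuous_interaction_integrand (V : SqInt E →L[ℂ] SqInt E) (f : SqInt E) :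
    Continuous fun s => ‖V (freeProp s f)‖ :=
  (V.continuous.comp (continuous_freeProp_apply f)).norm

theorem interaction_nonneg {T : ℝ} (hT : 0 ≤ T) (V : SqInt E →L[ℂ] SqInt E) (f : SqInt E) :
    0 ≤ interaction T V f :=
  intervalIntegral.integral_nonneg hT fun _ _ => norm_nonneg _

/-- The scattered part solves Duhamel's equation with source V e^{isΔ} f, so Grönwall bounds it by
the total source. -/
theorem IsMildSolution.norm_sub_freeProp_le {T : ℝ} (hT : 0 ≤ T) {V : SqInt E →L[ℂ] SqInt E}
    {f : SqInt E} {u : ℝ → SqInt E} (hu : IsMildSolution T V f u) {t : ℝ} (ht : t ∈ Icc 0 T) :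
    ‖u t - freeProp t f‖ ≤ interaction T V f * Real.exp (‖V‖ * T) := by
  have cr : Continuous fun t => ‖u t - freeProp t f‖ :=
    (hu.continuous.sub (continuous_freeProp_apply f)).norm
  have cf := continuous_interaction_integrand V f
  refine le_exp_of_le_add_integral cr (norm_nonneg V) (interaction_nonneg hT V f)
    (fun t => norm_nonneg _) (fun t ht => ?_) t ht
  have e1 : u t - freeProp t f =
      freeProp t (∫ s in (0 : ℝ)..t, (-Complex.I) • freeProp (-s) (V (u s))) := by
    rw [hu.duhamel t ht, map_add, add_sub_cancel_left]
  rw [e1, norm_freeProp]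
  calc ‖∫ s in (0 : ℝ)..t, (-Complex.I) • freeProp (-s) (V (u s))‖
      ≤ ∫ s in (0 : ℝ)..t, (‖V (freeProp s f)‖ + ‖V‖ * ‖u s - freeProp s f‖) := by
        refine intervalIntegral.norm_integral_le_of_norm_le ht.1
          (Eventually.of_forall fun s _ => ?_)
          ((cf.add (cr.const_mul ‖V‖)).intervalIntegrable _ _)
        rw [norm_smul, norm_neg, Complex.norm_I, one_mul, norm_freeProp]
        have : V (u s) = V (freeProp s f) + V (u s - freeProp s f) := by
          rw [← map_add, add_sub_cancel]
        rw [this]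
        exact (norm_add_le _ _).trans (by gcongr; exact V.le_opNorm _)
    _ = (∫ s in (0 : ℝ)..t, ‖V (freeProp s f)‖) +
          ‖V‖ * ∫ s in (0 : ℝ)..t, ‖u s - freeProp s f‖ := by
        rw [intervalIntegral.integral_add (cf.intervalIntegrable _ _)
          ((cr.const_mul ‖V‖).intervalIntegrable _ _),
          intervalIntegral.integral_const_mul]
    _ ≤ interaction T V f + ‖V‖ * ∫ s in (0 : ℝ)..t, ‖u s - freeProp s f‖ := by
        gcongr
        exact intervalIntegral.integral_mono_interval le_rfl ht.1 ht.2
          (Eventually.of_forall fun s => norm_nonneg _) (cf.intervalIntegrable _ _)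

theorem IsMildSolution.norm_integral_inner_remainder_le {T : ℝ} (hT : 0 ≤ T)
    {V : SqInt E →L[ℂ] SqInt E} (hV : ∀ x y, ‖inner ℂ x (V y)‖ ≤ ‖V x‖ * ‖y‖)
    {f : SqInt E} {u : ℝ → SqInt E} (hu : IsMildSolution T V f u) :
    ‖∫ s in (0 : ℝ)..T, inner ℂ (freeProp s f) (V (u s - freeProp s f))‖ ≤
      interaction T V f ^ 2 * Real.exp (‖V‖ * T) := by
  have cf := continuous_interaction_integrand V f
  calc ‖∫ s in (0 : ℝ)..T, inner ℂ (freeProp s f) (V (u s - freeProp s f))‖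
      ≤ ∫ s in (0 : ℝ)..T, ‖V (freeProp s f)‖ *
          (interaction T V f * Real.exp (‖V‖ * T)) := by
        refine intervalIntegral.norm_integral_le_of_norm_le hT
          (Eventually.of_forall fun s hs => ?_)
          ((cf.mul continuous_const).intervalIntegrable _ _)
        refine (hV _ _).trans ?_
        gcongr
        exact hu.norm_sub_freeProp_le hT (Ioc_subset_Icc_self hs)
    _ = interaction T V f ^ 2 * Real.exp (‖V‖ * T) := by
        rw [intervalIntegral.integral_mul_const, interaction]
        ring

/-- Pairing Duhamel's formula at time `T` with `f` expresses ∫⟨e^{isΔ} f, V u⟩ through `f` and `u T`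
(`full`). Equal final states make these integrals equal for the two potentials, so the first order
terms differ only by the remainders. -/
theorem norm_integral_inner_sub_le {T : ℝ} (hT : 0 ≤ T) {V₁ V₂ : SqInt E →L[ℂ] SqInt E}
    (hV₁ : ∀ x y, ‖inner ℂ x (V₁ y)‖ ≤ ‖V₁ x‖ * ‖y‖)
    (hV₂ : ∀ x y, ‖inner ℂ x (V₂ y)‖ ≤ ‖V₂ x‖ * ‖y‖) {f : SqInt E} {u₁ u₂ : ℝ → SqInt E}
    (hu₁ : IsMildSolution T V₁ f u₁) (hu₂ : IsMildSolution T V₂ f u₂) (h : u₁ T = u₂ T) :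
    ‖∫ s in (0 : ℝ)..T, inner ℂ (freeProp s f) (V₁ (freeProp s f) - V₂ (freeProp s f))‖ ≤
      interaction T V₁ f ^ 2 * Real.exp (‖V₁‖ * T) +
        interaction T V₂ f ^ 2 * Real.exp (‖V₂‖ * T) := by
  have cU : Continuous fun s => freeProp s f := continuous_freeProp_apply f
  have full : ∀ {V : SqInt E →L[ℂ] SqInt E} {u : ℝ → SqInt E}, IsMildSolution T V f u →
      ∫ s in (0 : ℝ)..T, inner ℂ (freeProp s f) (V (u s)) =
        Complex.I * inner ℂ f (freeProp (-T) (u T) - f) := by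
    intro V u hu
    have cV : Continuous fun s => freeProp (-s) (V (u s)) :=
      continuous_freeProp continuous_neg (V.continuous.comp hu.continuous)
    rw [hu.duhamel T ⟨hT, le_rfl⟩, freeProp_neg_freeProp, add_sub_cancel_left,
      intervalIntegral.integral_smul, inner_smul_right, ← mul_assoc, mul_neg, Complex.I_mul_I,
      neg_neg, one_mul]
    simp_rw [inner_freeProp_left]
    exact (innerSL ℂ f).intervalIntegral_comp_comm (cV.intervalIntegrable _ _)
  have split : ∀ {V : SqInt E →L[ℂ] SqInt E} {u : ℝ → SqInt E}, IsMildSolution T V f u →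
      ∫ s in (0 : ℝ)..T, inner ℂ (freeProp s f) (V (u s)) =
        (∫ s in (0 : ℝ)..T, inner ℂ (freeProp s f) (V (freeProp s f))) +
          ∫ s in (0 : ℝ)..T, inner ℂ (freeProp s f) (V (u s - freeProp s f)) := by
    intro V u hu
    rw [← intervalIntegral.integral_add
      ((cU.inner (V.continuous.comp cU) : Continuous fun s => inner ℂ (freeProp s f)
        (V (freeProp s f))).intervalIntegrable _ _)
      ((cU.inner (V.continuous.comp (hu.continuous.sub cU)) : Continuous fun s =>
        inner ℂ (freeProp s f) (V (u s - freeProp s f))).intervalIntegrable _ _)]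
    congr 1
    funext s
    rw [← inner_add_right, ← map_add, add_sub_cancel]
  have e : ∫ s in (0 : ℝ)..T, inner ℂ (freeProp s f) (V₁ (freeProp s f) - V₂ (freeProp s f)) =
      (∫ s in (0 : ℝ)..T, inner ℂ (freeProp s f) (V₂ (u₂ s - freeProp s f))) -
        ∫ s in (0 : ℝ)..T, inner ℂ (freeProp s f) (V₁ (u₁ s - freeProp s f)) := by
    simp_rw [inner_sub_right]
    rw [intervalIntegral.integral_sub
      ((cU.inner (V₁.continuous.comp cU) : Continuous fun s => inner ℂ (freeProp s f)
        (V₁ (freeProp s f))).intervalIntegrable _ _)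
      ((cU.inner (V₂.continuous.comp cU) : Continuous fun s => inner ℂ (freeProp s f)
        (V₂ (freeProp s f))).intervalIntegrable _ _)]
    have h1 := (split hu₁).symm.trans (full hu₁)
    have h2 := (split hu₂).symm.trans (full hu₂)
    rw [h] at h1
    linear_combination h1 - h2
  rw [e, add_comm]
  exact (norm_sub_le _ _).trans (add_le_add (hu₂.norm_integral_inner_remainder_le hT hV₂)
    (hu₁.norm_integral_inner_remainder_le hT hV₁))

theorem norm_integral_inner_sub_le_of_initialToFinalStateMap_eq {n : ℕ} {T : ℝ} (hT : 0 < T)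
    {V₁ V₂ : EuclideanSpace ℝ (Fin n) → ℂ} (hV₁ : MemLp V₁ ⊤ volume) (hV₂ : MemLp V₂ ⊤ volume)
    (hU : initialToFinalStateMap T V₁ = initialToFinalStateMap T V₂) (f : L2 n) :
    ‖∫ s in (0 : ℝ)..T, inner ℂ (freeProp s f)
        (mulOp hV₁.toLp (freeProp s f) - mulOp hV₂.toLp (freeProp s f))‖ ≤
      interaction T (mulOp hV₁.toLp) f ^ 2 * Real.exp (‖mulOp hV₁.toLp‖ * T) +
        interaction T (mulOp hV₂.toLp) f ^ 2 * Real.exp (‖mulOp hV₂.toLp‖ * T) := by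
  have sol : ∀ {V : EuclideanSpace ℝ (Fin n) → ℂ} (hV : MemLp V ⊤ volume),
      ∃ u, IsMildSolution T (mulOp hV.toLp) f u ∧ u T = initialToFinalStateMap T V f := by
    intro V hV
    have hex : ∃ u : ℝ → L2 n, IsPhysicalSolution T V f u := by
      obtain ⟨u, hu⟩ := exists_isMildSolution hT.le (mulOp hV.toLp) f
      exact ⟨u, hu.isPhysicalSolution hT.le hV⟩
    -- The solution chosen in the definition of the map is itself mild, so no uniqueness statement
    -- is required.
    refine ⟨_, hex.choose_spec.isMildSolution hT hV, ?_⟩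
    rw [initialToFinalStateMap, dif_pos hex, projIcc_right]
  obtain ⟨u₁, h1, e1⟩ := sol hV₁
  obtain ⟨u₂, h2, e2⟩ := sol hV₂
  exact norm_integral_inner_sub_le hT.le (norm_inner_mulOp_le hV₁) (norm_inner_mulOp_le hV₂) h1 h2
    (by rw [e1, e2, hU])

end

/-! ### Gaussian wave packets and their exact free evolution -/

section

open scoped RealInnerProductSpace
open Real (pi_pos)

variable {E : Type*} [NormedAddCommGroup E] [InnerProductSpace ℝ E] [FiniteDimensional ℝ E]
  [MeasurableSpace E] [BorelSpace E]

/-- Both sides are the same tempered distribution, by moving the Fourier integral onto the test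
function. -/
theorem fourier_toLp_of_integrable {f : E → ℂ} (hf₁ : Integrable f) (hf₂ : MemLp f 2 volume)
    (hF : MemLp (𝓕 f) 2 volume) : 𝓕 (hf₂.toLp : SqInt E) = hF.toLp := by
  have hinj : Function.Injective (Lp.toTemperedDistributionCLM ℂ (volume : Measure E) 2) :=
    LinearMap.ker_eq_bot.1 Lp.ker_toTemperedDistributionCLM_eq_bot
  apply hinj
  rw [Lp.toTemperedDistributionCLM_apply, Lp.toTemperedDistributionCLM_apply,
    ← Lp.fourier_toTemperedDistribution_eq]
  ext g
  rw [TemperedDistribution.fourier_apply, Lp.toTemperedDistribution_apply,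
    Lp.toTemperedDistribution_apply]
  have h1 : ∫ x, 𝓕 g x • (hf₂.toLp : SqInt E) x = ∫ x, 𝓕 g x • f x := by
    apply integral_congr_ae
    filter_upwards [hf₂.coeFn_toLp] with x hx
    rw [hx]
  have h2 : ∫ x, g x • (hF.toLp : SqInt E) x = ∫ x, g x • 𝓕 f x := by
    apply integral_congr_ae
    filter_upwards [hF.coeFn_toLp] with x hx
    rw [hx]
  rw [h1, h2]
  simpa using! VectorFourier.integral_fourierIntegral_smul_eq_flip (L := innerₗ E)
    (μ := volume) (ν := volume) Real.continuous_fourierChar continuous_inner g.integrable hf₁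

/-- The Gaussian `e^{-β|x-a|² + 2πi⟨k,x⟩}`, localised at `a` in space and at `k` in frequency. -/
def packet (β : ℂ) (a k : E) (x : E) : ℂ :=
  Complex.exp (-β * (‖x - a‖ : ℂ) ^ 2 + 2 * Real.pi * Complex.I * (⟪k, x⟫ : ℝ))

theorem continuous_packet (β : ℂ) (a k : E) : Continuous (packet β a k) := by
  have h1 : Continuous fun x : E => ((‖x - a‖ : ℝ) : ℂ) :=
    Complex.continuous_ofReal.comp (by fun_prop)
  have h2 : Continuous fun x : E => ((⟪k, x⟫ : ℝ) : ℂ) :=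
    Complex.continuous_ofReal.comp (by fun_prop)
  exact ((continuous_const.mul (h1.pow 2)).add (continuous_const.mul h2)).cexp

theorem norm_packet (β : ℂ) (a k x : E) :
    ‖packet β a k x‖ = Real.exp (-β.re * ‖x - a‖ ^ 2) := by
  rw [packet, Complex.norm_exp]
  congr 1
  have h1 : ((‖x - a‖ : ℂ) ^ 2) = ((‖x - a‖ ^ 2 : ℝ) : ℂ) := by push_cast; rfl
  rw [h1]
  simp [-Complex.ofReal_pow]

theorem integrable_exp_neg_mul_sq_norm_sub {δ : ℝ} (hδ : 0 < δ) (a : E) :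
    Integrable fun x : E => Real.exp (-δ * ‖x - a‖ ^ 2) := by
  have h := (GaussianFourier.integrable_cexp_neg_mul_sq_norm_add (V := E) (b := δ) (by simpa) 0 0).norm
  have h1 : Integrable fun x : E => Real.exp (-δ * ‖x‖ ^ 2) := by
    refine h.congr (Eventually.of_forall fun x => ?_)
    simp only
    rw [Complex.norm_exp]
    congr 1
    have h1 : ((‖x‖ : ℂ) ^ 2) = ((‖x‖ ^ 2 : ℝ) : ℂ) := by push_cast; rfl
    rw [h1]
    simp [-Complex.ofReal_pow]
  exact h1.comp_sub_right a

theorem integrable_packet {β : ℂ} (hβ : 0 < β.re) (a k : E) : Integrable (packet β a k) := by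
  refine (integrable_norm_iff (continuous_packet β a k).aestronglyMeasurable).1 ?_
  simp_rw [norm_packet]
  exact integrable_exp_neg_mul_sq_norm_sub hβ a

theorem memLp_packet {β : ℂ} (hβ : 0 < β.re) (a k : E) : MemLp (packet β a k) 2 volume := by
  rw [memLp_two_iff_integrable_sq_norm (continuous_packet β a k).aestronglyMeasurable]
  simp_rw [norm_packet, ← Real.exp_nat_mul]
  refine (integrable_exp_neg_mul_sq_norm_sub (mul_pos two_pos hβ) a).congr
    (Eventually.of_forall fun x => ?_)
  simp only
  congr 1
  push_cast
  ring

theorem fourier_packet {β : ℂ} (hβ : 0 < β.re) (a k w : E) :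
    𝓕 (packet β a k) w = ((Real.pi / β) ^ (Module.finrank ℝ E / 2 : ℂ) *
      Complex.exp (2 * Real.pi * Complex.I * (⟪a, k⟫ : ℝ))) *
        packet (Real.pi ^ 2 / β) k (-a) w := by
  have h1 := GaussianFourier.integral_cexp_neg_mul_sq_norm_add hβ (2 * Real.pi * Complex.I) (k - w)
  have h0 : β ≠ 0 := by rintro rfl; simp at hβ
  rw [Real.fourier_eq', ← integral_add_right_eq_self _ a]
  have h2 : ∀ v : E, Complex.exp ((-2 * Real.pi * (⟪v + a, w⟫ : ℝ) : ℝ) * Complex.I) •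
      packet β a k (v + a) = Complex.exp (2 * Real.pi * Complex.I * (⟪a, k⟫ : ℝ) -
        2 * Real.pi * Complex.I * (⟪a, w⟫ : ℝ)) *
        Complex.exp (-β * (‖v‖ : ℂ) ^ 2 + 2 * Real.pi * Complex.I * (⟪k - w, v⟫ : ℝ)) := by
    intro v
    rw [packet, smul_eq_mul, ← Complex.exp_add, ← Complex.exp_add, add_sub_cancel_right,
      inner_add_left, inner_add_right, inner_sub_left, real_inner_comm a k, real_inner_comm w v]
    congr 1
    push_cast
    ring
  simp_rw [h2]
  rw [integral_const_mul, h1, packet, inner_neg_left, norm_sub_rev k w, Complex.exp_sub]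
  have h3 : Complex.exp (2 * Real.pi * Complex.I * (⟪a, w⟫ : ℝ)) ≠ 0 := Complex.exp_ne_zero _
  have h4 : Complex.exp (-(Real.pi ^ 2 / β) * (‖w - k‖ : ℂ) ^ 2 +
      2 * Real.pi * Complex.I * ((-⟪a, w⟫ : ℝ) : ℂ)) =
      Complex.exp ((2 * Real.pi * Complex.I) ^ 2 * (‖w - k‖ : ℂ) ^ 2 / (4 * β)) /
        Complex.exp (2 * Real.pi * Complex.I * (⟪a, w⟫ : ℝ)) := by
    rw [← Complex.exp_sub]
    congr 1
    have : (2 * Real.pi * Complex.I) ^ 2 = -(4 * (Real.pi : ℂ) ^ 2) := by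
      rw [mul_pow, Complex.I_sq]; ring
    rw [this]
    push_cast
    field_simp
    ring
  rw [h4]
  field_simp

/-- The Gaussian wave packet as an element of `L²`. -/
def packetLp {β : ℂ} (hβ : 0 < β.re) (a k : E) : SqInt E := (memLp_packet hβ a k).toLp

theorem re_pi_sq_div_pos {β : ℂ} (hβ : 0 < β.re) : 0 < ((Real.pi : ℂ) ^ 2 / β).re := by
  have h1 : ((Real.pi : ℂ) ^ 2) = ((Real.pi ^ 2 : ℝ) : ℂ) := by push_cast; rfl
  have h0 : β ≠ 0 := by rintro rfl; simp at hβ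
  rw [h1, Complex.div_re]
  simp only [Complex.ofReal_re, Complex.ofReal_im, zero_mul, zero_div, add_zero]
  have := Complex.normSq_pos.2 h0
  positivity

theorem fourier_packetLp {β : ℂ} (hβ : 0 < β.re) (a k : E) :
    𝓕 (packetLp hβ a k) = ((Real.pi / β) ^ (Module.finrank ℝ E / 2 : ℂ) *
      Complex.exp (2 * Real.pi * Complex.I * (⟪a, k⟫ : ℝ))) •
        packetLp (re_pi_sq_div_pos hβ) k (-a) := by
  set C := ((Real.pi / β) ^ (Module.finrank ℝ E / 2 : ℂ) *
      Complex.exp (2 * Real.pi * Complex.I * (⟪a, k⟫ : ℝ)))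
  have h1 : 𝓕 (packet β a k) = C • packet (Real.pi ^ 2 / β) k (-a) :=
    funext fun w => fourier_packet hβ a k w
  have h2 : MemLp (𝓕 (packet β a k)) 2 volume := by
    rw [h1]
    exact (memLp_packet (re_pi_sq_div_pos hβ) k (-a)).const_smul C
  rw [packetLp, fourier_toLp_of_integrable (integrable_packet hβ a k) _ h2, packetLp,
    ← MemLp.toLp_const_smul]
  exact MemLp.toLp_congr _ _ (by rw [h1])

/-- In frequency the packet is a Gaussian about `k`. Expanding |w|² about `k` in the propagator's
phase, the quadratic part changes 1/b into 1/β, the linear part moves the centre by 4πs k, and the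
constant is a phase. -/
theorem coeFn_freeProp_packetLp {b : ℝ} (hb : 0 < b) {β : ℂ} (hβ : 0 < β.re) {s : ℝ}
    (h : 1 / β = 1 / b + 4 * s * Complex.I) (c k : E) :
    freeProp s (packetLp (β := b) (by simpa using hb) c k) =
      (Complex.exp (((-(4 * Real.pi ^ 2 * s * ‖k‖ ^ 2) : ℝ) : ℂ) * Complex.I) *
        ((Real.pi / b) ^ (Module.finrank ℝ E / 2 : ℂ) /
          (Real.pi / β) ^ (Module.finrank ℝ E / 2 : ℂ))) •
        packetLp hβ (c + (4 * Real.pi * s) • k) k := by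
  have hβ0 : β ≠ 0 := by rintro rfl; simp at hβ
  have hπ : (Real.pi : ℂ) ≠ 0 := by exact_mod_cast pi_pos.ne'
  have hz : (Real.pi / β : ℂ) ^ (Module.finrank ℝ E / 2 : ℂ) ≠ 0 := by
    rw [Complex.cpow_def_of_ne_zero (div_ne_zero hπ hβ0)]
    exact Complex.exp_ne_zero _
  have hb0 : (b : ℂ) ≠ 0 := by exact_mod_cast hb.ne'
  have hb' : 0 < ((b : ℂ)).re := by simpa using hb
  apply fourier_injective
  rw [fourier_freeProp, FourierTransform.fourier_smul, fourier_packetLp, fourier_packetLp,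
    map_smul, smul_smul]
  set X : ℂ := (Real.pi / b : ℂ) ^ (Module.finrank ℝ E / 2 : ℂ)
  set Y : ℂ := (Real.pi / β : ℂ) ^ (Module.finrank ℝ E / 2 : ℂ)
  set p : ℂ := Complex.exp (((-(4 * Real.pi ^ 2 * s * ‖k‖ ^ 2) : ℝ) : ℂ) * Complex.I) with hp
  set e₁ : ℂ := Complex.exp (2 * Real.pi * Complex.I * (⟪c, k⟫ : ℝ)) with he₁
  set e₂ : ℂ := Complex.exp (2 * Real.pi * Complex.I * (⟪c + (4 * Real.pi * s) • k, k⟫ : ℝ)) with he₂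
  rw [show p * (X / Y) * (Y * e₂) = X * (p * e₂) by field_simp, mul_smul, mul_smul]
  congr 1
  apply Lp.ext
  filter_upwards [Lp.coeFn_smul e₁
      (mulOp (memLp_freeSymbol s).toLp (packetLp (re_pi_sq_div_pos hb') k (-c))),
    coeFn_mulOp_toLp (memLp_freeSymbol s) (packetLp (re_pi_sq_div_pos hb') k (-c)),
    (memLp_packet (re_pi_sq_div_pos hb') k (-c)).coeFn_toLp,
    Lp.coeFn_smul (p * e₂) (packetLp (re_pi_sq_div_pos hβ) k (-(c + (4 * Real.pi * s) • k))),
    (memLp_packet (re_pi_sq_div_pos hβ) k (-(c + (4 * Real.pi * s) • k))).coeFn_toLp]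
    with w h1 h2 h3 h4 h5
  rw [h1, h4]
  simp only [Pi.smul_apply, smul_eq_mul]
  rw [h2]
  simp only [packetLp] at *
  rw [h3, h5, packet, packet, freeSymbol, hp, he₁, he₂]
  simp only [← Complex.exp_add]
  congr 1
  have hw : (‖w‖ : ℂ) ^ 2 = (‖w - k‖ : ℂ) ^ 2 + 2 * ((⟪k, w⟫ : ℝ) : ℂ) - (‖k‖ : ℂ) ^ 2 := by
    have h6 := norm_sub_sq_real w k
    rw [real_inner_comm] at h6
    have h7 : ‖w‖ ^ 2 = ‖w - k‖ ^ 2 + 2 * ⟪k, w⟫ - ‖k‖ ^ 2 := by linarith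
    exact_mod_cast congrArg ((↑) : ℝ → ℂ) h7
  have hβ' : (Real.pi : ℂ) ^ 2 / β = Real.pi ^ 2 / b + 4 * Real.pi ^ 2 * s * Complex.I := by
    rw [div_eq_mul_one_div, h]
    ring
  rw [hβ', inner_neg_left, inner_neg_left, inner_add_left, inner_add_left, inner_smul_left,
    inner_smul_left, real_inner_self_eq_norm_sq]
  push_cast
  rw [hw]
  simp only [conj_trivial]
  push_cast
  ring

end

/-! ### Modulus of a packet, and the time it spends in a ball -/

section

open scoped RealInnerProductSpace

variable {E : Type*} [NormedAddCommGroup E] [InnerProductSpace ℝ E] [FiniteDimensional ℝ E]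
  [MeasurableSpace E] [BorelSpace E]

/-- The exponent `b / (1 + (4bs)²)` of the modulus of a spreading Gaussian packet at time `s`. -/
def packetWidth (b s : ℝ) : ℝ := b / (1 + (4 * b * s) ^ 2)

/-- The amplitude of a spreading Gaussian packet at time `s` in dimension `n`. -/
def packetAmp (n : ℕ) (b s : ℝ) : ℝ := ‖(1 : ℂ) + 4 * b * s * Complex.I‖⁻¹ ^ ((n : ℝ) / 2)

theorem packetWidth_zero (b : ℝ) : packetWidth b 0 = b := by simp [packetWidth]

theorem packetAmp_zero (n : ℕ) (b : ℝ) : packetAmp n b 0 = 1 := by simp [packetAmp]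

theorem one_le_norm_one_add_mul_I (x : ℝ) : 1 ≤ ‖(1 : ℂ) + x * Complex.I‖ := by
  have := Complex.abs_re_le_norm ((1 : ℂ) + x * Complex.I)
  simpa using this

theorem one_le_norm_spread (b s : ℝ) : 1 ≤ ‖(1 : ℂ) + 4 * b * s * Complex.I‖ := by
  simpa using one_le_norm_one_add_mul_I (4 * b * s)

theorem packetAmp_nonneg (n : ℕ) (b s : ℝ) : 0 ≤ packetAmp n b s := by
  unfold packetAmp; positivity

theorem packetAmp_le_one (n : ℕ) (b s : ℝ) : packetAmp n b s ≤ 1 :=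
  Real.rpow_le_one (by positivity) (inv_le_one_of_one_le₀ (one_le_norm_spread b s)) (by positivity)

theorem continuous_packetAmp (n : ℕ) (b : ℝ) : Continuous (packetAmp n b) := by
  have h0 : ∀ s : ℝ, ‖(1 : ℂ) + 4 * b * s * Complex.I‖ ≠ 0 := fun s =>
    (one_pos.trans_le (one_le_norm_spread b s)).ne'
  have h1 : Continuous fun s : ℝ => ‖(1 : ℂ) + 4 * b * s * Complex.I‖ :=
    (continuous_const.add ((continuous_const.mul Complex.continuous_ofReal).mul
      continuous_const)).norm
  exact (h1.inv₀ h0).rpow_const fun s => Or.inr (by positivity)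

theorem continuous_packetWidth (b : ℝ) : Continuous (packetWidth b) := by
  unfold packetWidth
  exact continuous_const.div (by fun_prop) fun s => by positivity

theorem packetWidth_pos {b : ℝ} (hb : 0 < b) (s : ℝ) : 0 < packetWidth b s := by
  unfold packetWidth; positivity

theorem packetWidth_le {b s T : ℝ} (hb : 0 < b) (hs : s ∈ Icc 0 T) :
    packetWidth b T ≤ packetWidth b s := by
  unfold packetWidth
  have h1 := hs.1
  have h2 := hs.2
  gcongr

theorem re_ofReal_pos {b : ℝ} (hb : 0 < b) : 0 < ((b : ℂ)).re := by simpa using hb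

theorem norm_freeProp_packetLp {b : ℝ} (hb : 0 < b) (s : ℝ) (c k : E) :
    ∀ᵐ x, ‖freeProp s (packetLp (re_ofReal_pos hb) c k) x‖ =
      packetAmp (Module.finrank ℝ E) b s *
        Real.exp (-packetWidth b s * ‖x - (c + (4 * Real.pi * s) • k)‖ ^ 2) := by
  set z : ℂ := 1 + 4 * b * s * Complex.I with hz
  have hz0 : z ≠ 0 := norm_pos_iff.1 (one_pos.trans_le (one_le_norm_spread b s))
  have hb0 : (b : ℂ) ≠ 0 := by exact_mod_cast hb.ne'
  set β : ℂ := b / z with hβ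
  have hre : β.re = packetWidth b s := by
    have h1 : Complex.normSq z = 1 + (4 * b * s) ^ 2 := by
      rw [Complex.normSq_apply, hz]
      simp
      ring
    rw [hβ, Complex.div_re, h1, packetWidth]
    simp [hz]
  have hβ0 : 0 < β.re := by rw [hre]; exact packetWidth_pos hb s
  have h : 1 / β = 1 / b + 4 * s * Complex.I := by
    rw [hβ, hz]
    field_simp
  rw [coeFn_freeProp_packetLp hb hβ0 h]
  set p : ℂ := Complex.exp (((-(4 * Real.pi ^ 2 * s * ‖k‖ ^ 2) : ℝ) : ℂ) * Complex.I) with hp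
  set X : ℂ := (Real.pi / b : ℂ) ^ (Module.finrank ℝ E / 2 : ℂ) with hX
  set Y : ℂ := (Real.pi / β : ℂ) ^ (Module.finrank ℝ E / 2 : ℂ) with hY
  have hamp : ‖p * (X / Y)‖ = packetAmp (Module.finrank ℝ E) b s := by
    have he : (Module.finrank ℝ E / 2 : ℂ) = ((Module.finrank ℝ E / 2 : ℝ) : ℂ) := by push_cast; rfl
    rw [norm_mul, hp, Complex.norm_exp_ofReal_mul_I, one_mul, norm_div, hX, hY, he,
      Complex.norm_cpow_real, Complex.norm_cpow_real, ← Real.div_rpow (norm_nonneg _)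
      (norm_nonneg _), packetAmp, ← norm_div, ← norm_inv]
    congr 2
    have hπ : (Real.pi : ℂ) ≠ 0 := by exact_mod_cast Real.pi_pos.ne'
    have hq : (Real.pi / b : ℂ) / (Real.pi / β) = z⁻¹ := by
      rw [hβ]
      clear_value z
      field_simp
    rw [hq]
  filter_upwards [Lp.coeFn_smul (p * (X / Y)) (packetLp hβ0 (c + (4 * Real.pi * s) • k) k),
    (memLp_packet hβ0 (c + (4 * Real.pi * s) • k) k).coeFn_toLp] with x h1 h2
  rw [h1, Pi.smul_apply, norm_smul, hamp]
  simp only [packetLp] at *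
  rw [h2, norm_packet, hre]

theorem tsum_sq_le_sq_tsum (e : ℕ → ℝ≥0∞) : ∑' j, e j ^ 2 ≤ (∑' j, e j) ^ 2 := by
  rw [sq (∑' j, e j), ← ENNReal.tsum_mul_right]
  refine ENNReal.tsum_le_tsum fun j => ?_
  rw [sq]
  gcongr
  exact ENNReal.le_tsum j

theorem eLpNorm_two_le_tsum_restrict {α : Type*} [MeasurableSpace α] {μ : Measure α}
    {D : ℕ → Set α} (hU : ⋃ j, D j = univ) (g : α → ℂ) :
    eLpNorm g 2 μ ≤ ∑' j, eLpNorm g 2 (μ.restrict (D j)) := by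
  have h2 : ∀ ν : Measure α, eLpNorm g 2 ν ^ 2 = ∫⁻ x, ‖g x‖ₑ ^ 2 ∂ν := by
    intro ν
    have := eLpNorm_nnreal_pow_eq_lintegral (f := g) (μ := ν) (p := 2) two_ne_zero
    simpa using this
  rw [← (ENNReal.pow_right_strictMono two_ne_zero).le_iff_le, h2]
  calc ∫⁻ x, ‖g x‖ₑ ^ 2 ∂μ = ∫⁻ x in ⋃ j, D j, ‖g x‖ₑ ^ 2 ∂μ := by rw [hU, Measure.restrict_univ]
    _ ≤ ∑' j, ∫⁻ x in D j, ‖g x‖ₑ ^ 2 ∂μ := lintegral_iUnion_le _ _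
    _ = ∑' j, eLpNorm g 2 (μ.restrict (D j)) ^ 2 := by simp_rw [h2]
    _ ≤ _ := tsum_sq_le_sq_tsum _

theorem measurableSet_dyadicAnnulus (n j : ℕ) : MeasurableSet (dyadicAnnulus n j) := by
  cases j with
  | zero =>
    exact measurableSet_le (measurable_norm (α := EuclideanSpace ℝ (Fin n))) measurable_const
  | succ j =>
    exact (measurableSet_lt measurable_const
      (measurable_norm (α := EuclideanSpace ℝ (Fin n)))).inter
      (measurableSet_le (measurable_norm (α := EuclideanSpace ℝ (Fin n))) measurable_const)

theorem norm_le_of_mem_dyadicAnnulus {n j : ℕ} {x : EuclideanSpace ℝ (Fin n)}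
    (hx : x ∈ dyadicAnnulus n j) : ‖x‖ ≤ 2 ^ j := by
  cases j with
  | zero => simpa [dyadicAnnulus] using hx
  | succ j => exact hx.2

theorem iUnion_dyadicAnnulus (n : ℕ) : ⋃ j, dyadicAnnulus n j = univ := by
  refine eq_univ_of_forall fun x => mem_iUnion.2 ?_
  have hex : ∃ j : ℕ, ‖x‖ ≤ 2 ^ j := (pow_unbounded_of_one_lt ‖x‖ one_lt_two).imp fun _ h => h.le
  classical
  refine ⟨Nat.find hex, ?_⟩
  rcases hj : Nat.find hex with _ | j
  · have := Nat.find_spec hex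
    rw [hj] at this
    simpa [dyadicAnnulus] using this
  · refine ⟨?_, ?_⟩
    · have := Nat.find_min hex (m := j) (by omega)
      exact not_le.1 this
    · have := Nat.find_spec hex
      rwa [hj] at this

/-- A bound for the size on the ball of radius `R` of a Gaussian which has moved by `τ`. -/
def travelBound (δ R τ : ℝ) : ℝ := (Iio (2 * R)).indicator 1 τ + Real.exp (-(δ / 8) * τ ^ 2)

theorem travelBound_nonneg (δ R τ : ℝ) : 0 ≤ travelBound δ R τ :=
  add_nonneg (indicator_nonneg (fun _ _ => zero_le_one) _) (Real.exp_pos _).le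

/-- Once τ ≥ 2(R + ‖c‖), the centre is at distance at least τ/2 from `x`. Half of the exponent then
yields exp(-δτ²/8), and the other half is kept for integration in `x`. -/
theorem exp_neg_mul_sq_le_travelBound {δ : ℝ} (hδ : 0 < δ) {R τ : ℝ} {c ω x : E}
    (hω : ‖ω‖ = 1) (hx : ‖x‖ ≤ R) (hτ : 0 ≤ τ) :
    Real.exp (-δ * ‖x - (c + τ • ω)‖ ^ 2) ≤
      travelBound δ (R + ‖c‖) τ * Real.exp (-(δ / 2) * ‖x - (c + τ • ω)‖ ^ 2) := by
  set y := ‖x - (c + τ • ω)‖ with hy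
  have hy0 : 0 ≤ y := norm_nonneg _
  by_cases h : τ < 2 * (R + ‖c‖)
  · have h1 : 1 ≤ travelBound δ (R + ‖c‖) τ := by
      rw [travelBound, indicator_of_mem (mem_Iio.2 h)]
      simpa using (Real.exp_pos _).le
    have h2 : Real.exp (-δ * y ^ 2) ≤ Real.exp (-(δ / 2) * y ^ 2) := by
      apply Real.exp_le_exp.2
      nlinarith [mul_nonneg hδ.le (sq_nonneg y)]
    exact h2.trans (le_mul_of_one_le_left (Real.exp_pos _).le h1)
  · have h1 : Real.exp (-(δ / 8) * τ ^ 2) ≤ travelBound δ (R + ‖c‖) τ :=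
      le_add_of_nonneg_left (indicator_nonneg (fun _ _ => zero_le_one) _)
    refine le_trans ?_ (mul_le_mul_of_nonneg_right h1 (Real.exp_pos _).le)
    rw [← Real.exp_add]
    apply Real.exp_le_exp.2
    have h3 : τ ≤ y + (R + ‖c‖) := by
      have e : τ • ω = x - c - (x - (c + τ • ω)) := by abel
      have h4 : ‖τ • ω‖ = τ := by rw [norm_smul, hω, mul_one, Real.norm_eq_abs, abs_of_nonneg hτ]
      rw [← h4, e]
      refine (norm_sub_le _ _).trans ?_
      have := norm_sub_le x c
      linarith
    have h5 : τ / 2 ≤ y := by linarith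
    have h6 : τ ^ 2 / 4 ≤ y ^ 2 := by nlinarith
    nlinarith

/-- The substitution τ = l s produces the decisive factor 1/l; 2R is the length of the indicator's
interval and the square root is the full Gaussian integral. -/
theorem lintegral_travelBound_le {δ R l T : ℝ} (hδ : 0 < δ) (hR : 0 ≤ R) (hl : 0 < l) :
    ∫⁻ s in Ioc 0 T, ENNReal.ofReal (travelBound δ R (l * s)) ≤
      ENNReal.ofReal ((2 * R + Real.sqrt (8 * Real.pi / δ)) / l) := by
  have hm : Measurable fun s : ℝ => Real.exp (-(δ / 8) * (l * s) ^ 2) := by fun_prop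
  have h1 : ∀ s ∈ Ioc 0 T, ENNReal.ofReal (travelBound δ R (l * s)) ≤
      (Ioc 0 (2 * R / l)).indicator 1 s + ENNReal.ofReal (Real.exp (-(δ / 8) * (l * s) ^ 2)) := by
    intro s hs
    have h0 : (0 : ℝ) ≤ (Iio (2 * R)).indicator (1 : ℝ → ℝ) (l * s) :=
      indicator_nonneg (fun _ _ => zero_le_one) _
    rw [travelBound, ENNReal.ofReal_add h0 (Real.exp_pos _).le]
    gcongr
    by_cases h : l * s ∈ Iio (2 * R)
    · have h2 : s ∈ Ioc 0 (2 * R / l) := by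
        refine ⟨hs.1, ?_⟩
        rw [le_div_iff₀ hl, mul_comm]
        exact (mem_Iio.1 h).le
      rw [indicator_of_mem h, indicator_of_mem h2]
      simp
    · rw [indicator_of_notMem h]
      simp
  have h2 : ∫⁻ s : ℝ, ENNReal.ofReal (Real.exp (-(δ / 8) * (l * s) ^ 2)) =
      ENNReal.ofReal (Real.sqrt (8 * Real.pi / δ) / l) := by
    have e : (fun s : ℝ => Real.exp (-(δ / 8) * (l * s) ^ 2)) =
        fun s => Real.exp (-(δ / 8 * l ^ 2) * s ^ 2) := by
      funext s
      congr 1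
      ring
    rw [← ofReal_integral_eq_lintegral_ofReal]
    · rw [e, integral_gaussian]
      congr 1
      rw [show Real.pi / (δ / 8 * l ^ 2) = 8 * Real.pi / δ / l ^ 2 by field_simp,
        Real.sqrt_div' _ (sq_nonneg l), Real.sqrt_sq hl.le]
    · rw [e]
      exact integrable_exp_neg_mul_sq (by positivity)
    · exact Eventually.of_forall fun s => (Real.exp_pos _).le
  calc ∫⁻ s in Ioc 0 T, ENNReal.ofReal (travelBound δ R (l * s))
      ≤ ∫⁻ s in Ioc 0 T, ((Ioc 0 (2 * R / l)).indicator 1 s +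
          ENNReal.ofReal (Real.exp (-(δ / 8) * (l * s) ^ 2))) :=
        setLIntegral_mono' measurableSet_Ioc h1
    _ ≤ ∫⁻ s : ℝ, ((Ioc 0 (2 * R / l)).indicator 1 s +
          ENNReal.ofReal (Real.exp (-(δ / 8) * (l * s) ^ 2))) := setLIntegral_le_lintegral _ _
    _ = ENNReal.ofReal ((2 * R + Real.sqrt (8 * Real.pi / δ)) / l) := by
        rw [lintegral_add_right _ hm.ennreal_ofReal, h2, lintegral_indicator_one measurableSet_Ioc,
          Real.volume_Ioc, sub_zero, ← ENNReal.ofReal_add (by positivity) (by positivity), add_div]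

end

/-! ### The interaction of a fast packet is O(1/l) -/

section

variable {E : Type*} [NormedAddCommGroup E] [InnerProductSpace ℝ E] [FiniteDimensional ℝ E]
  [MeasurableSpace E] [BorelSpace E]

theorem eLpNorm_exp_neg_mul_sq_norm_sub (δ : ℝ) (a : E) :
    eLpNorm (fun x : E => Real.exp (-δ * ‖x - a‖ ^ 2)) 2 volume =
      eLpNorm (fun x : E => Real.exp (-δ * ‖x‖ ^ 2)) 2 volume := by
  have hm : AEStronglyMeasurable (fun x : E => Real.exp (-δ * ‖x‖ ^ 2)) volume :=
    Continuous.aestronglyMeasurable (by fun_prop)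
  exact eLpNorm_comp_measurePreserving hm (measurePreserving_sub_right volume a)

theorem eLpNorm_exp_neg_mul_sq_norm_lt_top {δ : ℝ} (hδ : 0 < δ) :
    eLpNorm (fun x : E => Real.exp (-δ * ‖x‖ ^ 2)) 2 volume < ∞ := by
  have hm : AEStronglyMeasurable (fun x : E => Real.exp (-δ * ‖x‖ ^ 2)) volume :=
    Continuous.aestronglyMeasurable (by fun_prop)
  refine ((memLp_two_iff_integrable_sq hm).2 ?_).2
  refine (integrable_exp_neg_mul_sq_norm_sub (E := E) (δ := 2 * δ) (by positivity) 0).congr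
    (Eventually.of_forall fun x => ?_)
  simp only [sub_zero, sq, ← Real.exp_add]
  congr 1
  ring

theorem four_pi_mul_smul (l s : ℝ) (ω : E) :
    (4 * Real.pi * s) • ((l / (4 * Real.pi)) • ω) = (l * s) • ω := by
  rw [smul_smul]
  congr 1
  field_simp

theorem norm_freeProp_packetLp_le {b : ℝ} (hb : 0 < b) {T s : ℝ} (hs : s ∈ Icc 0 T) {l : ℝ}
    (c ω : E) :
    ∀ᵐ x, ‖freeProp s (packetLp (re_ofReal_pos hb) c ((l / (4 * Real.pi)) • ω)) x‖ ≤
      Real.exp (-packetWidth b T * ‖x - (c + (l * s) • ω)‖ ^ 2) := by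
  filter_upwards [norm_freeProp_packetLp hb s c ((l / (4 * Real.pi)) • ω)] with x hx
  rw [hx, four_pi_mul_smul]
  refine (mul_le_of_le_one_left (Real.exp_pos _).le (packetAmp_le_one _ _ _)).trans ?_
  apply Real.exp_le_exp.2
  have := mul_le_mul_of_nonneg_right (packetWidth_le hb hs)
    (sq_nonneg ‖x - (c + (l * s) • ω)‖)
  linarith

/-- On each annulus Hölder separates the supremum of `V` from the L² size of the packet; the
packet's smallest exponent on [0, T], the one at time `T`, serves for all times. -/
theorem enorm_mulOp_freeProp_packetLp_le {n : ℕ} {V : EuclideanSpace ℝ (Fin n) → ℂ}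
    (hV : MemLp V ∞ volume) {b : ℝ} (hb : 0 < b) {T s : ℝ} (hs : s ∈ Icc 0 T) {l : ℝ} (hl : 0 < l)
    (c : EuclideanSpace ℝ (Fin n)) {ω : EuclideanSpace ℝ (Fin n)} (hω : ‖ω‖ = 1) :
    ‖mulOp hV.toLp (freeProp s
        (packetLp (re_ofReal_pos hb) c ((l / (4 * Real.pi)) • ω)))‖ₑ ≤
      ∑' j : ℕ, eLpNorm V ∞ (volume.restrict (dyadicAnnulus n j)) *
        (ENNReal.ofReal (travelBound (packetWidth b T) (2 ^ j + ‖c‖) (l * s)) *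
          eLpNorm (fun x : EuclideanSpace ℝ (Fin n) =>
            Real.exp (-(packetWidth b T / 2) * ‖x‖ ^ 2)) 2 volume) := by
  set g := freeProp s (packetLp (re_ofReal_pos hb) c ((l / (4 * Real.pi)) • ω)) with hg
  have hδ := packetWidth_pos hb T
  set δ := packetWidth b T with hδdef
  have hls : 0 ≤ l * s := mul_nonneg hl.le hs.1
  rw [Lp.enorm_def, eLpNorm_congr_ae (coeFn_mulOp_toLp hV g)]
  refine (eLpNorm_two_le_tsum_restrict (iUnion_dyadicAnnulus n) _).trans
    (ENNReal.tsum_le_tsum fun j => ?_)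
  set μ := volume.restrict (dyadicAnnulus n j) with hμ
  have hgm : AEStronglyMeasurable g μ := (Lp.aestronglyMeasurable g).restrict
  refine (eLpNorm_smul_le_eLpNorm_top_mul_eLpNorm (p := 2) (f := g) hgm V).trans ?_
  gcongr
  set t := travelBound δ (2 ^ j + ‖c‖) (l * s) with ht
  have ht0 : 0 ≤ t := travelBound_nonneg _ _ _
  have h1 : eLpNorm g 2 μ ≤
      eLpNorm (fun x => t * Real.exp (-(δ / 2) * ‖x - (c + (l * s) • ω)‖ ^ 2)) 2 μ := by
    refine eLpNorm_mono_ae ?_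
    filter_upwards [ae_restrict_of_ae (norm_freeProp_packetLp_le (l := l) hb hs c ω),
      ae_restrict_mem (measurableSet_dyadicAnnulus n j)] with x hx hxj
    refine hx.trans ?_
    rw [Real.norm_eq_abs, abs_of_nonneg (mul_nonneg ht0 (Real.exp_pos _).le)]
    exact exp_neg_mul_sq_le_travelBound hδ hω (norm_le_of_mem_dyadicAnnulus hxj) hls
  refine h1.trans ((eLpNorm_mono_measure _ Measure.restrict_le_self).trans ?_)
  have h2 := eLpNorm_const_smul t (fun x : EuclideanSpace ℝ (Fin n) =>
    Real.exp (-(δ / 2) * ‖x - (c + (l * s) • ω)‖ ^ 2)) 2 volume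
  rw [eLpNorm_exp_neg_mul_sq_norm_sub, Real.enorm_eq_ofReal ht0] at h2
  exact h2.le

/-- Integrated in time, the j-th annulus contributes O(2^j / l) times the supremum of `V` there, and
the sum over `j` is the triple norm. -/
theorem exists_interaction_packetLp_le {n : ℕ} {V : EuclideanSpace ℝ (Fin n) → ℂ}
    (hV : MemLp V ∞ volume) (htriple : tripleNorm V < ∞) {b : ℝ} (hb : 0 < b) {T : ℝ} (hT : 0 ≤ T)
    (c : EuclideanSpace ℝ (Fin n)) {ω : EuclideanSpace ℝ (Fin n)} (hω : ‖ω‖ = 1) :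
    ∃ K : ℝ, ∀ l : ℝ, 0 < l → interaction T (mulOp hV.toLp)
      (packetLp (re_ofReal_pos hb) c ((l / (4 * Real.pi)) • ω)) ≤ K / l := by
  have hδ := packetWidth_pos hb T
  set δ := packetWidth b T with hδdef
  set C₀ := eLpNorm (fun x : EuclideanSpace ℝ (Fin n) => Real.exp (-(δ / 2) * ‖x‖ ^ 2)) 2 volume
    with hC₀
  have hC₀top : C₀ < ∞ := eLpNorm_exp_neg_mul_sq_norm_lt_top (half_pos hδ)
  set C₁ : ℝ := 2 + 2 * ‖c‖ + Real.sqrt (8 * Real.pi / δ) with hC₁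
  have hC₁0 : 0 ≤ C₁ := by positivity
  refine ⟨C₁ * (C₀ * tripleNorm V).toReal, fun l hl => ?_⟩
  set f := packetLp (re_ofReal_pos hb) c ((l / (4 * Real.pi)) • ω) with hf
  set a : ℕ → ℝ≥0∞ := fun j => eLpNorm V ∞ (volume.restrict (dyadicAnnulus n j)) with ha
  have hmeas : ∀ j : ℕ, Measurable fun s : ℝ =>
      ENNReal.ofReal (travelBound δ (2 ^ j + ‖c‖) (l * s)) := by
    intro j
    refine Measurable.ennreal_ofReal ?_
    unfold travelBound
    refine Measurable.add ?_ (by fun_prop)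
    exact (measurable_one.indicator measurableSet_Iio).comp (measurable_const_mul l)
  have hj : ∀ j : ℕ, (2 * (2 ^ j + ‖c‖) + Real.sqrt (8 * Real.pi / δ)) / l ≤ 2 ^ j * (C₁ / l) := by
    intro j
    have h1 : (1 : ℝ) ≤ 2 ^ j := one_le_pow₀ one_le_two
    have h2 : 2 * (2 ^ j + ‖c‖) + Real.sqrt (8 * Real.pi / δ) ≤ 2 ^ j * C₁ := by
      have h3 : 0 ≤ 2 * ‖c‖ + Real.sqrt (8 * Real.pi / δ) := by positivity
      rw [hC₁]
      nlinarith
    rw [← mul_div_assoc]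
    gcongr
  have key : ENNReal.ofReal (interaction T (mulOp hV.toLp) f) ≤
      ENNReal.ofReal (C₁ / l) * (C₀ * tripleNorm V) := by
    calc ENNReal.ofReal (interaction T (mulOp hV.toLp) f)
        = ∫⁻ s in Ioc 0 T, ‖mulOp hV.toLp (freeProp s f)‖ₑ := by
          rw [interaction, intervalIntegral.integral_of_le hT, ofReal_integral_eq_lintegral_ofReal]
          · simp_rw [ofReal_norm]
          · exact (continuous_interaction_integrand _ f).integrableOn_Ioc
          · exact Eventually.of_forall fun s => norm_nonneg _
      _ ≤ ∫⁻ s in Ioc 0 T, ∑' j : ℕ, a j *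
            (ENNReal.ofReal (travelBound δ (2 ^ j + ‖c‖) (l * s)) * C₀) :=
          setLIntegral_mono' measurableSet_Ioc fun s hs =>
            enorm_mulOp_freeProp_packetLp_le hV hb (Ioc_subset_Icc_self hs) hl c hω
      _ = ∑' j : ℕ, a j *
            ((∫⁻ s in Ioc 0 T, ENNReal.ofReal (travelBound δ (2 ^ j + ‖c‖) (l * s))) * C₀) := by
          rw [lintegral_tsum fun j => (((hmeas j).mul_const _).const_mul _).aemeasurable]
          refine tsum_congr fun j => ?_
          rw [lintegral_const_mul _ ((hmeas j).mul_const _), lintegral_mul_const _ (hmeas j)]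
      _ ≤ ∑' j : ℕ, a j * ((2 ^ j * ENNReal.ofReal (C₁ / l)) * C₀) := by
          refine ENNReal.tsum_le_tsum fun j => ?_
          gcongr
          refine (lintegral_travelBound_le hδ (by positivity) hl).trans ?_
          refine (ENNReal.ofReal_le_ofReal (hj j)).trans ?_
          rw [ENNReal.ofReal_mul (by positivity), ENNReal.ofReal_pow (by positivity),
            ENNReal.ofReal_ofNat]
      _ = ENNReal.ofReal (C₁ / l) * (C₀ * tripleNorm V) := by
          rw [tripleNorm, ← ENNReal.tsum_mul_left, ← ENNReal.tsum_mul_left]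
          refine tsum_congr fun j => ?_
          ring
  have htop : C₀ * tripleNorm V ≠ ∞ := ENNReal.mul_ne_top hC₀top.ne htriple.ne
  rw [← ENNReal.ofReal_toReal htop, ← ENNReal.ofReal_mul (by positivity),
    ENNReal.ofReal_le_ofReal_iff (by positivity)] at key
  rwa [mul_div_right_comm]

end

/-! ### The limit of infinite speed: vanishing integrals over rays -/

section

open scoped RealInnerProductSpace

variable {E : Type*} [NormedAddCommGroup E] [InnerProductSpace ℝ E] [FiniteDimensional ℝ E]
  [MeasurableSpace E] [BorelSpace E]

theorem inner_mulOp_sub_mulOp {m₁ m₂ : E → ℂ} (h₁ : MemLp m₁ ∞ volume) (h₂ : MemLp m₂ ∞ volume)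
    (g : SqInt E) :
    inner ℂ g (mulOp h₁.toLp g - mulOp h₂.toLp g) =
      ∫ x, (m₁ x - m₂ x) * ((‖g x‖ ^ 2 : ℝ) : ℂ) := by
  rw [L2.inner_def]
  refine integral_congr_ae ?_
  filter_upwards [Lp.coeFn_sub (mulOp h₁.toLp g) (mulOp h₂.toLp g), coeFn_mulOp_toLp h₁ g,
    coeFn_mulOp_toLp h₂ g] with x h3 h4 h5
  rw [h3, Pi.sub_apply, h4, h5, ← sub_mul, RCLike.inner_apply, mul_assoc, RCLike.mul_conj]
  norm_cast

/-- The integral of `W` against the Gaussian `exp (-w ‖x - p‖²)`. -/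
def gaussAvg (W : E → ℂ) (w : ℝ) (p : E) : ℂ := ∫ x, W x * (Real.exp (-w * ‖x - p‖ ^ 2) : ℂ)

theorem tendsto_gaussAvg {W : E → ℂ} (hW : Integrable W) {X : Type*} {F : Filter X}
    [F.IsCountablyGenerated] {w : X → ℝ} {w₀ : ℝ} {p : X → E} {p₀ : E} (hw0 : ∀ t, 0 ≤ w t)
    (hw : Tendsto w F (𝓝 w₀)) (hp : Tendsto p F (𝓝 p₀)) :
    Tendsto (fun t => gaussAvg W (w t) (p t)) F (𝓝 (gaussAvg W w₀ p₀)) := by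
  refine tendsto_integral_filter_of_dominated_convergence (fun x => ‖W x‖)
    (Eventually.of_forall fun t => ?_) (Eventually.of_forall fun t => Eventually.of_forall fun x => ?_)
    hW.norm (Eventually.of_forall fun x => ?_)
  · exact hW.aestronglyMeasurable.mul (Continuous.aestronglyMeasurable (by fun_prop))
  · rw [norm_mul, Complex.norm_real, Real.norm_eq_abs, abs_of_pos (Real.exp_pos _)]
    refine mul_le_of_le_one_right (norm_nonneg _) (Real.exp_le_one_iff.2 ?_)
    have := mul_nonneg (hw0 t) (sq_nonneg ‖x - p t‖)
    linarith
  · refine tendsto_const_nhds.mul ?_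
    refine (Complex.continuous_ofReal.tendsto _).comp ((Real.continuous_exp.tendsto _).comp ?_)
    exact hw.neg.mul ((tendsto_const_nhds.sub hp).norm.pow 2)

theorem continuous_gaussAvg {W : E → ℂ} (hW : Integrable W) {w : ℝ → ℝ} {p : ℝ → E}
    (hw0 : ∀ t, 0 ≤ w t) (hw : Continuous w) (hp : Continuous p) :
    Continuous fun t => gaussAvg W (w t) (p t) :=
  continuous_iff_continuousAt.2 fun t => tendsto_gaussAvg hW hw0 (hw.tendsto t) (hp.tendsto t)

theorem inner_freeProp_packetLp {m₁ m₂ : E → ℂ} (h₁ : MemLp m₁ ∞ volume) (h₂ : MemLp m₂ ∞ volume)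
    {b : ℝ} (hb : 0 < b) (s l : ℝ) (c ω : E) :
    inner ℂ (freeProp s (packetLp (re_ofReal_pos hb) c ((l / (4 * Real.pi)) • ω)))
      (mulOp h₁.toLp (freeProp s (packetLp (re_ofReal_pos hb) c ((l / (4 * Real.pi)) • ω))) -
        mulOp h₂.toLp (freeProp s (packetLp (re_ofReal_pos hb) c ((l / (4 * Real.pi)) • ω)))) =
      ((packetAmp (Module.finrank ℝ E) b s ^ 2 : ℝ) : ℂ) *
        gaussAvg (fun x => m₁ x - m₂ x) (2 * packetWidth b s) (c + (l * s) • ω) := by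
  rw [inner_mulOp_sub_mulOp, gaussAvg, ← integral_const_mul]
  refine integral_congr_ae ?_
  filter_upwards [norm_freeProp_packetLp hb s c ((l / (4 * Real.pi)) • ω)] with x hx
  rw [hx, four_pi_mul_smul, mul_pow, ← Real.exp_nat_mul, Complex.ofReal_mul]
  have e : ((2 : ℕ) : ℝ) * (-packetWidth b s * ‖x - (c + (l * s) • ω)‖ ^ 2) =
      -(2 * packetWidth b s) * ‖x - (c + (l * s) • ω)‖ ^ 2 := by
    push_cast
    ring
  rw [e]
  ring

/-- A function of `τ` dominating the Gaussian averages of `W` along a line in direction `ω`. -/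
def lineAvg (W : E → ℂ) (δ : ℝ) (c ω : E) (τ : ℝ) : ℝ :=
  ∫ x, ‖‖W x‖ * Real.exp (-δ * (τ - ⟪x - c, ω⟫) ^ 2)‖

/-- By Fubini: integrating first in τ replaces the Gaussian by the constant √(π/δ), whatever `x` is.
-/
theorem integrable_lineAvg {W : E → ℂ} (hW : Integrable W) {δ : ℝ} (hδ : 0 < δ) (c ω : E) :
    Integrable (lineAvg W δ c ω) := by
  have hm : AEStronglyMeasurable (fun q : ℝ × E =>
      ‖W q.2‖ * Real.exp (-δ * (q.1 - ⟪q.2 - c, ω⟫) ^ 2))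
      ((volume : Measure ℝ).prod (volume : Measure E)) := by
    refine (hW.aestronglyMeasurable.comp_snd.norm).mul (Continuous.aestronglyMeasurable ?_)
    fun_prop
  have hshift : ∀ x : E, (fun τ : ℝ => Real.exp (-δ * (τ - ⟪x - c, ω⟫) ^ 2)) =
      fun τ => (fun τ : ℝ => Real.exp (-δ * τ ^ 2)) (τ - ⟪x - c, ω⟫) := fun x => rfl
  have hint : Integrable (fun q : ℝ × E =>
      ‖W q.2‖ * Real.exp (-δ * (q.1 - ⟪q.2 - c, ω⟫) ^ 2))
      ((volume : Measure ℝ).prod (volume : Measure E)) := by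
    rw [integrable_prod_iff' hm]
    refine ⟨Eventually.of_forall fun x => ?_, ?_⟩
    · have h1 := (integrable_exp_neg_mul_sq hδ).comp_sub_right ⟪x - c, ω⟫
      exact h1.const_mul ‖W x‖
    · have e : (fun x : E => ∫ τ : ℝ, ‖‖W x‖ * Real.exp (-δ * (τ - ⟪x - c, ω⟫) ^ 2)‖) =
          fun x => ‖W x‖ * Real.sqrt (Real.pi / δ) := by
        funext x
        have h1 : ∀ τ : ℝ, ‖‖W x‖ * Real.exp (-δ * (τ - ⟪x - c, ω⟫) ^ 2)‖ =
            ‖W x‖ * Real.exp (-δ * (τ - ⟪x - c, ω⟫) ^ 2) := fun τ => by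
          rw [Real.norm_eq_abs, abs_of_nonneg (by positivity)]
        simp_rw [h1]
        rw [integral_const_mul, hshift x,
          integral_sub_right_eq_self (fun τ : ℝ => Real.exp (-δ * τ ^ 2)), integral_gaussian]
      simp only
      rw [e]
      exact hW.norm.mul_const _
  exact hint.integral_norm_prod_left

theorem norm_gaussAvg_le_lineAvg {W : E → ℂ} (hW : Integrable W) {δ w : ℝ} (hδ : 0 < δ)
    (hw : δ ≤ w) (c : E) {ω : E} (hω : ‖ω‖ = 1) (τ : ℝ) :
    ‖gaussAvg W w (c + τ • ω)‖ ≤ lineAvg W δ c ω τ := by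
  refine (norm_integral_le_integral_norm _).trans ?_
  refine integral_mono_of_nonneg (Eventually.of_forall fun x => norm_nonneg _) ?_
    (Eventually.of_forall fun x => ?_)
  · refine Integrable.norm ?_
    refine hW.norm.mul_bdd (c := 1) (Continuous.aestronglyMeasurable (by fun_prop))
      (Eventually.of_forall fun x => ?_)
    rw [Real.norm_eq_abs, abs_of_pos (Real.exp_pos _), Real.exp_le_one_iff]
    have := mul_nonneg hδ.le (sq_nonneg (τ - ⟪x - c, ω⟫))
    linarith
  · simp only [norm_mul, Complex.norm_real, Real.norm_eq_abs, Real.abs_exp]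
    rw [abs_norm]
    refine mul_le_mul_of_nonneg_left (Real.exp_le_exp.2 ?_) (norm_nonneg (W x))
    have h1 : (τ - ⟪x - c, ω⟫) ^ 2 ≤ ‖x - (c + τ • ω)‖ ^ 2 := by
      have h2 := abs_real_inner_le_norm (x - (c + τ • ω)) ω
      have h3 : ⟪x - (c + τ • ω), ω⟫ = ⟪x - c, ω⟫ - τ := by
        rw [← sub_sub, inner_sub_left (x - c), real_inner_smul_left, real_inner_self_eq_norm_sq, hω]
        ring
      rw [h3, hω, mul_one, abs_sub_comm] at h2
      rw [← sq_abs (τ - _)]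
      gcongr
    nlinarith [mul_le_mul hw h1 (sq_nonneg _) (hδ.le.trans hw)]

/-- After τ = l s the hypothesis bounds an integral over (0, lT] by l · C/l² = C/l. At fixed τ the
time τ/l tends to 0, so amplitude and width tend to their initial values, and `lineAvg` dominates
uniformly in `l`. -/
theorem integral_Ioi_gaussAvg_eq_zero {W : E → ℂ} (hW : Integrable W) {n : ℕ} {b T : ℝ} (hb : 0 < b)
    (hT : 0 < T) (c : E) {ω : E} (hω : ‖ω‖ = 1) {C : ℝ}
    (h : ∀ l : ℝ, 0 < l → ‖∫ s in (0 : ℝ)..T, ((packetAmp n b s ^ 2 : ℝ) : ℂ) *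
      gaussAvg W (2 * packetWidth b s) (c + (l * s) • ω)‖ ≤ C / l ^ 2) :
    ∫ τ in Ioi (0 : ℝ), gaussAvg W (2 * b) (c + τ • ω) = 0 := by
  set G : ℝ → ℝ → ℂ := fun l τ => ((packetAmp n b (τ / l) ^ 2 : ℝ) : ℂ) *
    gaussAvg W (2 * packetWidth b (τ / l)) (c + τ • ω) with hG
  have hGc : ∀ l, Continuous (G l) := by
    intro l
    have hd : Continuous fun τ : ℝ => τ / l := continuous_id.div_const l
    refine (Complex.continuous_ofReal.comp (((continuous_packetAmp n b).comp hd).pow 2)).mul ?_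
    exact continuous_gaussAvg hW (fun τ => mul_nonneg zero_le_two (packetWidth_pos hb _).le)
      (continuous_const.mul ((continuous_packetWidth b).comp hd)) (by fun_prop)
  have hδ : 0 < 2 * packetWidth b T := mul_pos two_pos (packetWidth_pos hb T)
  have hlim : Tendsto (fun l : ℝ => ∫ τ in Ioi (0 : ℝ), (Iic (l * T)).indicator (G l) τ) atTop
      (𝓝 (∫ τ in Ioi (0 : ℝ), gaussAvg W (2 * b) (c + τ • ω))) := by
    refine tendsto_integral_filter_of_dominated_convergence
      (lineAvg W (2 * packetWidth b T) c ω) (Eventually.of_forall fun l => ?_) ?_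
      (integrable_lineAvg hW hδ c ω).integrableOn (Eventually.of_forall fun τ => ?_)
    · exact ((hGc l).aestronglyMeasurable.indicator measurableSet_Iic)
    · filter_upwards [eventually_gt_atTop 0] with l hl
      filter_upwards [ae_restrict_mem measurableSet_Ioi] with τ hτ
      by_cases hm : τ ∈ Iic (l * T)
      · rw [indicator_of_mem hm]
        have hmem : τ / l ∈ Icc 0 T :=
          ⟨div_nonneg (le_of_lt hτ) hl.le, (div_le_iff₀' hl).2 hm⟩
        rw [hG, norm_mul, Complex.norm_real, Real.norm_eq_abs, abs_of_nonneg (sq_nonneg _)]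
        refine (mul_le_of_le_one_left (norm_nonneg _)
          (pow_le_one₀ (packetAmp_nonneg _ _ _) (packetAmp_le_one _ _ _))).trans ?_
        exact norm_gaussAvg_le_lineAvg hW hδ
          (mul_le_mul_of_nonneg_left (packetWidth_le hb hmem) zero_le_two) c hω τ
      · rw [indicator_of_notMem hm, norm_zero]
        exact integral_nonneg fun x => norm_nonneg _
    · have h0 : Tendsto (fun l : ℝ => τ / l) atTop (𝓝 0) := tendsto_const_nhds.div_atTop tendsto_id
      have hA : Tendsto (fun l : ℝ => ((packetAmp n b (τ / l) ^ 2 : ℝ) : ℂ)) atTop (𝓝 1) := by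
        have := (((continuous_packetAmp n b).tendsto 0).comp h0).pow 2
        rw [packetAmp_zero, one_pow] at this
        have h1 := (Complex.continuous_ofReal.tendsto 1).comp this
        rwa [Complex.ofReal_one] at h1
      have hw : Tendsto (fun l : ℝ => 2 * packetWidth b (τ / l)) atTop (𝓝 (2 * b)) := by
        have := ((continuous_packetWidth b).tendsto 0).comp h0
        rw [packetWidth_zero] at this
        exact tendsto_const_nhds.mul this
      have hg := hA.mul (tendsto_gaussAvg hW
        (fun l => mul_nonneg zero_le_two (packetWidth_pos hb (τ / l)).le) hw
        (tendsto_const_nhds (x := c + τ • ω)))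
      rw [one_mul] at hg
      refine hg.congr' ?_
      filter_upwards [eventually_ge_atTop (τ / T)] with l hl
      rw [indicator_of_mem]
      exact (div_le_iff₀ hT).1 hl
  have hbound : ∀ᶠ l : ℝ in atTop,
      ‖∫ τ in Ioi (0 : ℝ), (Iic (l * T)).indicator (G l) τ‖ ≤ C / l := by
    filter_upwards [eventually_gt_atTop 0] with l hl
    have hcov := intervalIntegral.smul_integral_comp_mul_left (a := 0) (b := T) (G l) l
    have e : ∫ τ in Ioi (0 : ℝ), (Iic (l * T)).indicator (G l) τ =
        l • ∫ s in (0 : ℝ)..T, G l (l * s) := by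
      rw [hcov, mul_zero, intervalIntegral.integral_of_le (by positivity),
        setIntegral_indicator measurableSet_Iic, Ioi_inter_Iic]
    have e' : ∀ s : ℝ, G l (l * s) = ((packetAmp n b s ^ 2 : ℝ) : ℂ) *
        gaussAvg W (2 * packetWidth b s) (c + (l * s) • ω) := by
      intro s
      rw [hG]
      simp only [mul_div_cancel_left₀ s hl.ne']
    rw [e, norm_smul, Real.norm_eq_abs, abs_of_pos hl]
    simp_rw [e']
    calc _ ≤ l * (C / l ^ 2) := mul_le_mul_of_nonneg_left (h l hl) hl.le
      _ = C / l := by field_simp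
  have hzero : Tendsto (fun l : ℝ => C / l) atTop (𝓝 0) := tendsto_const_nhds.div_atTop tendsto_id
  exact tendsto_nhds_unique hlim (squeeze_zero_norm' hbound hzero)

/-- A ray starting further along is again such a ray, so by subtraction the integral over every
segment from `c` along ω vanishes; its derivative at length 0 is the average at `c`. -/
theorem gaussAvg_eq_zero_of_integral_Ioi {W : E → ℂ} (hW : Integrable W) {w : ℝ} (hw : 0 < w)
    {ω : E} (hω : ‖ω‖ = 1)
    (h : ∀ c : E, ∫ τ in Ioi (0 : ℝ), gaussAvg W w (c + τ • ω) = 0) (c : E) :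
    gaussAvg W w c = 0 := by
  set φ : ℝ → ℂ := fun τ => gaussAvg W w (c + τ • ω) with hφ
  have hc : Continuous φ :=
    continuous_gaussAvg hW (fun _ => hw.le) continuous_const (by fun_prop)
  have hint : Integrable φ := (integrable_lineAvg hW hw c ω).mono' hc.aestronglyMeasurable
    (Eventually.of_forall fun τ => norm_gaussAvg_le_lineAvg hW hw le_rfl c hω τ)
  have htail : ∀ a : ℝ, ∫ τ in Ioi a, φ τ = 0 := by
    intro a
    have e := (measurePreserving_add_right (volume : Measure ℝ) a).setIntegral_preimage_emb
      (measurableEmbedding_addRight a) φ (Ioi a)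
    rw [← e, preimage_add_const_Ioi, sub_self]
    rw [← h (c + a • ω)]
    refine setIntegral_congr_fun measurableSet_Ioi fun τ _ => ?_
    simp only [hφ]
    congr 1
    rw [add_smul]
    abel
  have hI : ∀ a : ℝ, ∫ τ in (0 : ℝ)..a, φ τ = 0 := by
    intro a
    rw [← intervalIntegral.integral_Ioi_sub_Ioi' hint.integrableOn hint.integrableOn, htail, htail,
      sub_zero]
  have hd := hc.deriv_integral φ 0 0
  rw [funext hI, deriv_const] at hd
  have := hd.symm
  simpa [hφ] using this

end

/-! ### Injectivity of Gaussian averaging, and the conclusion -/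

section

variable {E : Type*} [NormedAddCommGroup E] [InnerProductSpace ℝ E] [FiniteDimensional ℝ E]
  [MeasurableSpace E] [BorelSpace E]

theorem ae_eq_zero_of_fourier_eq_zero {W : E → ℂ} (hW : Integrable W) (h : 𝓕 W = 0) :
    ∀ᵐ x, W x = 0 := by
  refine ae_eq_zero_of_integral_contDiff_smul_eq_zero hW.locallyIntegrable fun g hg hgs => ?_
  have hg' : ContDiff ℝ (⊤ : ℕ∞) fun x => (g x : ℂ) := Complex.ofRealCLM.contDiff.comp hg
  have hgs' : HasCompactSupport fun x => (g x : ℂ) :=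
    hgs.comp_left (g := fun r : ℝ => (r : ℂ)) Complex.ofReal_zero
  set G : 𝓢(E, ℂ) := hgs'.toSchwartzMap hg' with hG
  have h0 : ∀ F : 𝓢(E, ℂ), ∫ x, 𝓕 F x • W x = ∫ x, F x • 𝓕 W x := fun F => by
    simpa using! VectorFourier.integral_fourierIntegral_smul_eq_flip (L := innerₗ E)
      (μ := volume) (ν := volume) Real.continuous_fourierChar continuous_inner
      F.integrable hW
  have h1 := h0 (𝓕⁻ G)
  rw [h, FourierTransform.fourier_fourierInv_eq] at h1
  simpa [hG, Complex.real_smul] using h1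

/-- The averages are the convolution of `W` with a Gaussian. The Fourier transform of the Gaussian
never vanishes, so that of `W` must. -/
theorem ae_eq_zero_of_gaussAvg_eq_zero {W : E → ℂ} (hW : Integrable W) {w : ℝ} (hw : 0 < w)
    (h : ∀ c, gaussAvg W w c = 0) : ∀ᵐ x, W x = 0 := by
  have hwre : 0 < ((w : ℂ)).re := re_ofReal_pos hw
  refine ae_eq_zero_of_fourier_eq_zero hW (funext fun ξ => ?_)
  have hconv : MeasureTheory.convolution W (packet (w : ℂ) (0 : E) 0) (ContinuousLinearMap.mul ℂ ℂ) volume = 0 := by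
    funext c
    rw [MeasureTheory.convolution, Pi.zero_apply, ← h c, gaussAvg]
    refine integral_congr_ae (Eventually.of_forall fun x => ?_)
    simp [packet, norm_sub_rev c x]
  have h1 := Real.fourier_mul_convolution_eq hW (integrable_packet hwre (0 : E) 0) ξ
  have h2 : 𝓕 (packet (w : ℂ) (0 : E) 0) ξ ≠ 0 := by
    rw [fourier_packet hwre]
    have hw0 : (w : ℂ) ≠ 0 := by exact_mod_cast hw.ne'
    have hπ : (Real.pi : ℂ) ≠ 0 := by exact_mod_cast Real.pi_pos.ne'
    refine mul_ne_zero (mul_ne_zero ?_ (Complex.exp_ne_zero _)) (Complex.exp_ne_zero _)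
    rw [Ne, Complex.cpow_eq_zero_iff]
    exact fun hc => div_ne_zero hπ hw0 hc.1
  rw [hconv] at h1
  have h3 : 𝓕 (0 : E → ℂ) ξ = 0 := by simp [Real.fourier_eq]
  rw [h3] at h1
  exact (mul_eq_zero.1 h1.symm).resolve_right h2

theorem ae_eq_of_initialToFinalStateMap_eq {n : ℕ} (hn : 0 < n) {T : ℝ} (hT : 0 < T)
    {V₁ V₂ : EuclideanSpace ℝ (Fin n) → ℂ}
    (hV₁_one : Integrable V₁) (hV₁_top : MemLp V₁ ∞ volume)
    (hV₂_one : Integrable V₂) (hV₂_top : MemLp V₂ ∞ volume)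
    (hV₁ : tripleNorm V₁ < ∞) (hV₂ : tripleNorm V₂ < ∞)
    (hU : initialToFinalStateMap T V₁ = initialToFinalStateMap T V₂) :
    V₁ =ᵐ[volume] V₂ := by
  set ω : EuclideanSpace ℝ (Fin n) := EuclideanSpace.single ⟨0, hn⟩ 1 with hωdef
  have hω : ‖ω‖ = 1 := by simp [hωdef]
  have hW : Integrable fun x => V₁ x - V₂ x := hV₁_one.sub hV₂_one
  -- Packets of width parameter b = 1 are used; the factor 2 comes from squaring the modulus.
  have hzero := ae_eq_zero_of_gaussAvg_eq_zero hW (w := 2 * 1) (by norm_num) fun c =>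
    gaussAvg_eq_zero_of_integral_Ioi hW (by norm_num) hω (fun c => by
      obtain ⟨K₁, hK₁⟩ := exists_interaction_packetLp_le hV₁_top hV₁ one_pos hT.le c hω
      obtain ⟨K₂, hK₂⟩ := exists_interaction_packetLp_le hV₂_top hV₂ one_pos hT.le c hω
      refine integral_Ioi_gaussAvg_eq_zero hW (n := Module.finrank ℝ (EuclideanSpace ℝ (Fin n)))
        one_pos hT c hω
        (C := K₁ ^ 2 * Real.exp (‖mulOp hV₁_top.toLp‖ * T) +
          K₂ ^ 2 * Real.exp (‖mulOp hV₂_top.toLp‖ * T)) fun l hl => ?_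
      have key := norm_integral_inner_sub_le_of_initialToFinalStateMap_eq hT hV₁_top hV₂_top hU
        (packetLp (re_ofReal_pos one_pos) c ((l / (4 * Real.pi)) • ω))
      simp_rw [inner_freeProp_packetLp hV₁_top hV₂_top one_pos _ l c ω] at key
      refine key.trans ?_
      have h1 := pow_le_pow_left₀ (interaction_nonneg hT.le _ _) (hK₁ l hl) 2
      have h2 := pow_le_pow_left₀ (interaction_nonneg hT.le _ _) (hK₂ l hl) 2
      rw [add_div, mul_div_right_comm, mul_div_right_comm, ← div_pow, ← div_pow]
      gcongr) c
  filter_upwards [hzero] with x hx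
  exact sub_eq_zero.1 hx

end

end InitialToFinal

end

theorem theorem1 (n : ℕ) (hn : 2 ≤ n) (T : ℝ) (hT : 0 < T)
    (V₁ V₂ : EuclideanSpace ℝ (Fin n) → ℂ)
    (hV₁_one : MemLp V₁ 1 volume) (hV₁_top : MemLp V₁ ∞ volume)
    (hV₂_one : MemLp V₂ 1 volume) (hV₂_top : MemLp V₂ ∞ volume)
    (hV₁ : InitialToFinal.tripleNorm V₁ < ∞) (hV₂ : InitialToFinal.tripleNorm V₂ < ∞)
    (hU : InitialToFinal.initialToFinalStateMap T V₁ =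
      InitialToFinal.initialToFinalStateMap T V₂) :
    V₁ =ᵐ[volume] V₂ := by
  exact InitialToFinal.ae_eq_of_initialToFinalStateMap_eq (by omega) hT
    (memLp_one_iff_integrable.1 hV₁_one) hV₁_top (memLp_one_iff_integrable.1 hV₂_one) hV₂_top
    hV₁ hV₂ hU
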